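/- Consider Gödel's universe, rescaled by a constant so that in cylindrical coordinates $(\tau,r,\phi,\zeta)$ (with $r\ge 0$, $\phi$ of period $2\pi$, and the axis $r=0$ regular in the coordinates $x=r\cos\phi$, $y=r\sin\phi$) its metric is $$-d\tau^2-2\sqrt2\,r^2\,d\phi\,d\tau+r^2(1-r^2)\,d\phi^2+\frac{dr^2}{1+r^2}+d\zeta^2,$$ time-oriented so that $\partial/\partial\tau$ is future-pointing. An $n$-segment lightlike path from $A$ to $B$ ($n\ge1$) consists of events $A_0=A,A_1,\dots,A_n=B$ and, for each $1\le i\le n$, a segment of a future-pointing null geodesic from $A_{i-1}$ to $A_i$. It is closed if $A=B$. Let $\mathcal O$ be the event on the axis with $r=\tau=\zeta=0$, and let $\mathcal H=\{r=1\}$ be the horizon. (a) The minimum of $\tau(B)$, over all 3-segment lightlike paths from $\mathcal O$ that meet $\mathcal H$, where $B$ is the future endpoint of the path, exists and equals $$m=\tfrac32(\sqrt2-1)\pi-\sqrt2\,\arctan\!\left(3\sqrt{\tfrac35}\right)\approx 0.3052$$ (the decimal value being correct to four places). The minimum over those paths whose first segment ends on $\mathcal H$ is also $m$. (b) $m>0$,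 and every closed lightlike path, based at any event, has more than six segments. -/

import Mathlib

noncomputable section

namespace Goedel

/-- Events of Goedel's universe in the global coordinates `(τ, x, y, ζ)`, where `x = r cos φ` and
`y = r sin φ` for the cylindrical coordinates `(τ, r, φ, ζ)`. -/
abbrev Event : Type := Fin 4 → ℝ

/-- The time coordinate `τ`. -/
def tau (p : Event) : ℝ := p 0

/-- The radial coordinate `r`. -/
def radius (p : Event) : ℝ := Real.sqrt (p 1 ^ 2 + p 2 ^ 2)

/-- The event on the axis `r = 0` with `τ = ζ = 0`. -/
def origin : Event := 0

/-- The components at `p` of the metric of Goedel's universe (scaled to unit rotation parameter),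
`-dτ² - 2√2 r² dφ dτ + r²(1 - r²) dφ² + (1 + r²)⁻¹ dr² + dζ²`,
in the coordinates `(τ, x, y, ζ)`, where `r² dφ = x dy - y dx` and `r dr = x dx + y dy`. -/
def metric (p : Event) : Matrix (Fin 4) (Fin 4) ℝ :=
  !![-1, Real.sqrt 2 * p 2, -(Real.sqrt 2 * p 1), 0;
     Real.sqrt 2 * p 2, 1 - p 2 ^ 2 - p 1 ^ 2 / (1 + p 1 ^ 2 + p 2 ^ 2),
       p 1 * p 2 - p 1 * p 2 / (1 + p 1 ^ 2 + p 2 ^ 2), 0;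
     -(Real.sqrt 2 * p 1), p 1 * p 2 - p 1 * p 2 / (1 + p 1 ^ 2 + p 2 ^ 2),
       1 - p 1 ^ 2 - p 2 ^ 2 / (1 + p 1 ^ 2 + p 2 ^ 2), 0;
     0, 0, 0, 1]

/-- The inner product `g(v, w)` of two tangent vectors at `p`. -/
def inner4 (p : Event) (v w : Fin 4 → ℝ) : ℝ := ∑ i, ∑ j, metric p i j * v i * w j

/-- The metric in cylindrical coordinates: the line element of a velocity vector
`(τ', r', φ', ζ')` at the event with cylindrical coordinates `(τ, r, φ, ζ)`. -/
theorem inner4_cylindrical (τ r φ ζ τ' r' φ' ζ' : ℝ) :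
    inner4 ![τ, r * Real.cos φ, r * Real.sin φ, ζ]
        ![τ', r' * Real.cos φ - r * Real.sin φ * φ', r' * Real.sin φ + r * Real.cos φ * φ', ζ']
        ![τ', r' * Real.cos φ - r * Real.sin φ * φ', r' * Real.sin φ + r * Real.cos φ * φ', ζ'] =
      -τ' ^ 2 - 2 * Real.sqrt 2 * r ^ 2 * φ' * τ' + r ^ 2 * (1 - r ^ 2) * φ' ^ 2
        + (1 + r ^ 2)⁻¹ * r' ^ 2 + ζ' ^ 2 := by
  have h : 1 + (r * Real.cos φ) ^ 2 + (r * Real.sin φ) ^ 2 = 1 + r ^ 2 := by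
    have := Real.sin_sq_add_cos_sq φ
    linear_combination r ^ 2 * this
  have hr : (1 + r ^ 2) ≠ 0 := by positivity
  have hs : Real.sin φ ^ 2 = 1 - Real.cos φ ^ 2 := by
    have := Real.sin_sq_add_cos_sq φ
    linarith
  have hs4 : Real.sin φ ^ 4 = (1 - Real.cos φ ^ 2) ^ 2 := by rw [← hs]; ring
  simp only [inner4, metric, Fin.sum_univ_four]
  simp [h]
  field_simp
  ring_nf
  simp only [hs, hs4]
  ring

/-- The metric is nondegenerate; its determinant in the coordinates `(τ, x, y, ζ)` is `-1`. -/
theorem det_metric (p : Event) : (metric p).det = -1 := by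
  have h2 : Real.sqrt 2 ^ 2 = 2 := Real.sq_sqrt (by norm_num)
  have hr : (1 + p 1 ^ 2 + p 2 ^ 2) ≠ 0 := by positivity
  simp [metric, Matrix.det_succ_row_zero, Fin.sum_univ_succ, Fin.succAbove]
  field_simp
  ring_nf
  simp only [h2]
  ring

/-- The partial derivative `∂ₖ gᵢⱼ` at `p`. -/
def metricDeriv (p : Event) (k i j : Fin 4) : ℝ :=
  fderiv ℝ (fun q : Event => metric q i j) p (Pi.single k 1)

/-- The Christoffel symbols of the first kind, `Γₖᵢⱼ = (∂ᵢ gₖⱼ + ∂ⱼ gₖᵢ - ∂ₖ gᵢⱼ) / 2`. -/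
def christoffel (p : Event) (k i j : Fin 4) : ℝ :=
  (metricDeriv p i k j + metricDeriv p j k i - metricDeriv p k i j) / 2

/-- `γ`, restricted to `[0, 1]`, is an affinely parametrised future-pointing null geodesic segment:
with velocity `v` and coordinate acceleration `a`, it satisfies the geodesic equation
`gₖⱼ aʲ + Γₖᵢⱼ vⁱ vʲ = 0` (equivalent to `aᵏ + Γᵏᵢⱼ vⁱ vʲ = 0`, as `g` is nondegenerate), the vector
`v` is null, and `g(∂/∂τ, v) < 0`, where `∂/∂τ` is the fluid flow vector. -/
def IsFutureNullGeodesic (γ : ℝ → Event) : Prop :=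
  ∃ v a : ℝ → Fin 4 → ℝ, ∀ s ∈ Set.Icc (0 : ℝ) 1,
    HasDerivWithinAt γ (v s) (Set.Icc 0 1) s ∧
    HasDerivWithinAt v (a s) (Set.Icc 0 1) s ∧
    (∀ k, ∑ j, metric (γ s) k j * a s j
        + ∑ i, ∑ j, christoffel (γ s) k i j * v s i * v s j = 0) ∧
    inner4 (γ s) (v s) (v s) = 0 ∧
    inner4 (γ s) (Pi.single 0 1) (v s) < 0

/-- A lightlike path with `n` segments: events `A₀, …, Aₙ` and, for each `i < n`, a future-pointing
null geodesic segment from `Aᵢ` to `Aᵢ₊₁`. -/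
structure LightlikePath (n : ℕ) where
  /-- the successive endpoints of the segments -/
  node : Fin (n + 1) → Event
  /-- the segments, each parametrised by `[0, 1]` -/
  seg : Fin n → ℝ → Event
  isGeodesic : ∀ i, IsFutureNullGeodesic (seg i)
  seg_zero : ∀ i, seg i 0 = node i.castSucc
  seg_one : ∀ i, seg i 1 = node i.succ

/-- The past endpoint of a lightlike path. -/
def LightlikePath.source {n : ℕ} (p : LightlikePath n) : Event := p.node 0

/-- The future endpoint of a lightlike path. -/
def LightlikePath.target {n : ℕ} (p : LightlikePath n) : Event := p.node (Fin.last n)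

/-- Some point of the path lies on the horizon `r = 1`. -/
def LightlikePath.MeetsHorizon {n : ℕ} (p : LightlikePath n) : Prop :=
  ∃ i, ∃ s ∈ Set.Icc (0 : ℝ) 1, radius (p.seg i s) = 1

/-- The number `(3/2)(√2 - 1)π - √2 arctan(3√(3/5))`. -/
def tauMin : ℝ :=
  3 / 2 * (Real.sqrt 2 - 1) * Real.pi - Real.sqrt 2 * Real.arctan (3 * Real.sqrt (3 / 5))

end Goedel

end

/-! Gödel's universe is the universal cover of SU(1,1) with a left-invariant metric, times a line.
Put α = τ/√2 and b = (x+iy)e^{-iα}; the event becomes the matrix with first row (a, b), a =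
√(1+|b|²)e^{iα}, together with the lift α of arg a. A null geodesic becomes a solution of g' = gX, X
= (iη s; s̄ -iη), with s rotating at rate 2η and |s|² ≤ 2η², the slack being motion along ζ
(`IsFlow`, `exists_isFlow`). Left translations preserve flows, so each segment multiplies by a step
(A, B) that starts at the identity. Conservation of angular momentum gives |B| ≤ 1, and the light
cone gives A ≥ `profile` |B| (`IsFlow.exists_step`).

A product has time α₀ + α + arg(1 + b₀b̄/(a₀a)). Once the horizon is reached, at α ≥ `profile 1`,
two further steps add at least their two profiles plus the argument of 1 + Xδ + YX + Yδ̄, where X,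
Y, δ have norm at most 1/√2. `two_step_gain` bounds this below. Each variable in turn is isolated as
1 + ξ with |ξ| = k·(its norm), so that the argument is at least -arcsin |ξ|. If k ≥ 1/√2,
lengthening the variable to norm 1/√2 does not raise the total (`profile_sub_arcsin_ge`); if k <
1/√2, two losses of π/6 suffice, as π/3 ≤ arctan(3√(3/5)). When all norms are 1/√2 the sum is
(2+p+q+pq)/2 with |p| = |q| = 1, and its argument is at least -arctan(3√(3/5)), with equality at p =
q = -1/4 - i√15/4. Three planar half circles realise this value (`exists_optimal_path`).

A path from the origin that first touches the horizon in segment 1, 2 or 3 has at most two steps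
left, so its final time is at least `leastTime`; a path that stays inside has increasing time
(`leastTime_le_or_inside`). As `leastTime` > 0, three steps from the origin always end at positive
time. A closed path with at most six segments, translated to the origin and cut after three, would
have its cut point at positive time by its first half and at negative time by its reversed second
half. -/

noncomputable section

namespace Goedel

open Real Set ComplexConjugate Filter Topology

/-! ### The least-time profile and its closed form -/

/-- The least value of `τ / √2` at radius `r ≤ 1` along a causal curve from the origin. -/
def profile (r : ℝ) : ℝ := ∫ u in (0 : ℝ)..r, √(1 - u ^ 2) / (√2 * (1 + u ^ 2))

theorem continuous_profile_integrand :
    Continuous fun u : ℝ => √(1 - u ^ 2) / (√2 * (1 + u ^ 2)) := by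
  refine Continuous.div (by fun_prop) (by fun_prop) fun u => ?_
  positivity

theorem hasDerivAt_profile (r : ℝ) :
    HasDerivAt profile (√(1 - r ^ 2) / (√2 * (1 + r ^ 2))) r :=
  continuous_profile_integrand.integral_hasStrictDerivAt 0 r |>.hasDerivAt

theorem continuous_profile : Continuous profile :=
  continuous_iff_continuousAt.2 fun r => (hasDerivAt_profile r).continuousAt

@[simp] theorem profile_zero : profile 0 = 0 := by simp [profile]

theorem monotone_profile : Monotone profile :=
  monotone_of_deriv_nonneg (fun r => (hasDerivAt_profile r).differentiableAt) fun r => by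
    rw [(hasDerivAt_profile r).deriv]; positivity

/-- The substitution u = sin ξ removes the root; the difference of the two sides has zero derivative
and vanishes at 0. -/
theorem profile_sin {ξ : ℝ} (h0 : 0 ≤ ξ) (h1 : ξ ≤ π / 2) :
    profile (sin ξ) = (1 - 1 / √2) * ξ +
      arctan ((√2 - 1) * (sin ξ * cos ξ) / (1 + (√2 - 1) * sin ξ ^ 2)) := by
  have h2 : √2 ^ 2 = 2 := sq_sqrt (by norm_num)
  have hs1 : 1 ≤ √2 := one_le_sqrt.2 (by norm_num)
  have hD : ∀ x : ℝ, 0 < 1 + (√2 - 1) * sin x ^ 2 := fun x => by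
    have := mul_nonneg (sub_nonneg.2 hs1) (sq_nonneg (sin x)); linarith
  set F : ℝ → ℝ := fun x => profile (sin x) - ((1 - 1 / √2) * x +
      arctan ((√2 - 1) * (sin x * cos x) / (1 + (√2 - 1) * sin x ^ 2))) with hF
  have hd : ∀ x ∈ Icc 0 (π / 2), HasDerivAt F 0 x := by
    intro x hx
    have hc : 0 ≤ cos x := cos_nonneg_of_mem_Icc ⟨by linarith [hx.1, pi_pos], hx.2⟩
    have e1 := (hasDerivAt_profile (sin x)).comp x (hasDerivAt_sin x)
    have e2 : HasDerivAt (fun x => (√2 - 1) * (sin x * cos x)) _ x :=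
      ((hasDerivAt_sin x).mul (hasDerivAt_cos x)).const_mul (√2 - 1)
    have e3 : HasDerivAt (fun x => 1 + (√2 - 1) * sin x ^ 2) _ x :=
      (((hasDerivAt_sin x).pow 2).const_mul (√2 - 1)).const_add 1
    have e4 := (e2.div e3 (hD x).ne').arctan
    have e5 := e1.sub (((hasDerivAt_id x).const_mul (1 - 1 / √2)).add e4)
    refine e5.congr_deriv ?_
    have hcs : √(1 - sin x ^ 2) = cos x := by
      rw [← cos_sq', sqrt_sq hc]
    have hD1 := (hD x).ne'
    have hN : (1 + (√2 - 1) * sin x ^ 2) ^ 2 + ((√2 - 1) * (sin x * cos x)) ^ 2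
        = 1 + sin x ^ 2 := by
      rw [mul_pow, mul_pow, cos_sq']; linear_combination (sin x ^ 2) * h2
    have hN' : 1 + ((√2 - 1) * (sin x * cos x) / (1 + (√2 - 1) * sin x ^ 2)) ^ 2
        = (1 + sin x ^ 2) / (1 + (√2 - 1) * sin x ^ 2) ^ 2 := by
      rw [← hN]; field_simp
    have hp : (1 + sin x ^ 2) ≠ 0 := by positivity
    simp only [Pi.div_apply, hN', hcs]
    have hcc : cos x ^ 2 = 1 - sin x ^ 2 := cos_sq' x
    have hw : √2 ≠ 0 := by positivity
    rw [show ∀ s c w D : ℝ, (1 + s ^ 2) ≠ 0 → w ≠ 0 → D ≠ 0 →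
      c / (w * (1 + s ^ 2)) * c - ((1 - 1 / w) * 1 + 1 / ((1 + s ^ 2) / D ^ 2) *
        (((w - 1) * (c * c + s * -s) * D - (w - 1) * (s * c) *
          ((w - 1) * ((2 : ℕ) * s ^ (2 - 1) * c))) / D ^ 2)) =
      (c ^ 2 - (w - 1) * (1 + s ^ 2) - w * ((w - 1) * (c ^ 2 - s ^ 2) * D
        - 2 * (w - 1) ^ 2 * s ^ 2 * c ^ 2)) / (w * (1 + s ^ 2)) from
      fun s c w D h1 h2 h3 => by push_cast; field_simp; ring, div_eq_zero_iff]
    · left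
      linear_combination (1 - √2 * (√2 - 1) * (1 + (√2 - 1) * sin x ^ 2)
        + 2 * √2 * (√2 - 1) ^ 2 * sin x ^ 2) * hcc + (√2 * sin x ^ 2 - 1) * h2
    all_goals assumption
  have hconst := constant_of_derivWithin_zero (f := F) (a := 0) (b := π / 2)
    (fun x hx => (hd x hx).differentiableAt.differentiableWithinAt)
    (fun x hx => ((hd x ⟨hx.1, hx.2.le⟩).hasDerivWithinAt).derivWithin
      (uniqueDiffOn_Icc (by positivity) x ⟨hx.1, hx.2.le⟩)) ξ ⟨h0, h1⟩
  have : F 0 = 0 := by simp [hF]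
  rw [this] at hconst
  linarith

theorem profile_one : profile 1 = (1 - 1 / √2) * (π / 2) := by
  simpa using profile_sin (ξ := π / 2) (by positivity) le_rfl

/-- The arctan in `profile_sin` is the argument of D + iN, and (D + iN)e^{iξ} = cos ξ + i√2 sin ξ.
The identity gives `amp` along the extremal half circle. -/
theorem exp_profile_sin {ξ : ℝ} (h0 : 0 ≤ ξ) (h1 : ξ ≤ π / 2) :
    (√(1 + sin ξ ^ 2) : ℂ) * Complex.exp (profile (sin ξ) * Complex.I) =
      (cos ξ + √2 * sin ξ * Complex.I) * Complex.exp (-(ξ / √2 : ℝ) * Complex.I) := by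
  have h2 : √2 ^ 2 = 2 := sq_sqrt (by norm_num)
  have hs1 : 1 ≤ √2 := one_le_sqrt.2 (by norm_num)
  have hD : 0 < 1 + (√2 - 1) * sin ξ ^ 2 := by
    have := mul_nonneg (sub_nonneg.2 hs1) (sq_nonneg (sin ξ)); linarith
  have hN : (1 + (√2 - 1) * sin ξ ^ 2) ^ 2 + ((√2 - 1) * (sin ξ * cos ξ)) ^ 2
      = 1 + sin ξ ^ 2 := by
    rw [mul_pow, mul_pow, cos_sq']; linear_combination (sin ξ ^ 2) * h2
  set D := 1 + (√2 - 1) * sin ξ ^ 2 with hDdef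
  set N := (√2 - 1) * (sin ξ * cos ξ) with hNdef
  have hp : 0 < √(1 + sin ξ ^ 2) := by positivity
  have hroot : √(1 + (N / D) ^ 2) = √(1 + sin ξ ^ 2) / D := by
    rw [← sqrt_sq hD.le, ← sqrt_div (by positivity), sqrt_sq hD.le, ← hN]; congr 1; field_simp
  have key : (√(1 + sin ξ ^ 2) : ℂ) * Complex.exp (arctan (N / D) * Complex.I) =
      D + N * Complex.I := by
    rw [Complex.exp_mul_I, ← Complex.ofReal_cos, ← Complex.ofReal_sin, cos_arctan, sin_arctan,
      hroot]
    have : (√(1 + sin ξ ^ 2) : ℂ) ≠ 0 := by exact_mod_cast hp.ne'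
    have : (D : ℂ) ≠ 0 := by exact_mod_cast hD.ne'
    push_cast
    field_simp
  have key2 : (D + N * Complex.I : ℂ) * Complex.exp (ξ * Complex.I) =
      cos ξ + √2 * sin ξ * Complex.I := by
    rw [Complex.exp_mul_I, ← Complex.ofReal_cos, ← Complex.ofReal_sin]
    have hc : cos ξ ^ 2 = 1 - sin ξ ^ 2 := cos_sq' ξ
    apply Complex.ext
    · simp only [Complex.mul_re, Complex.add_re, Complex.ofReal_re, Complex.ofReal_im, Complex.I_re,
        Complex.I_im, Complex.add_im, Complex.mul_im]
      linear_combination cos ξ * hDdef - sin ξ * hNdef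
    · simp only [Complex.mul_re, Complex.add_re, Complex.ofReal_re, Complex.ofReal_im, Complex.I_re,
        Complex.I_im, Complex.add_im, Complex.mul_im]
      linear_combination sin ξ * hDdef + cos ξ * hNdef + (√2 - 1) * sin ξ * hc
  rw [profile_sin h0 h1, ← key2, ← key, mul_assoc, mul_assoc, ← Complex.exp_add, ← Complex.exp_add]
  congr 2
  rw [← hNdef, ← hDdef]
  push_cast
  ring

/-- Lengthening a step that is used against a leverage `k ≥ 1/√2` never increases the
final time. -/
theorem profile_sub_arcsin_ge {k r : ℝ} (hk : 1 / √2 ≤ k) (hk1 : k < 1) (h0 : 0 ≤ r)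
    (h1 : r ≤ 1) :
    profile 1 - arcsin (k * (1 / √2)) ≤ profile r - arcsin (k * (r / √(1 + r ^ 2))) := by
  have hs : 0 < √2 := by positivity
  have hk0 : 0 < k := lt_of_lt_of_le (by positivity) hk
  have hlt : ∀ x : ℝ, 0 ≤ x → x / √(1 + x ^ 2) < 1 := fun x hx => by
    rw [div_lt_one (by positivity)]
    exact lt_sqrt_of_sq_lt (by linarith)
  have hd : ∀ x : ℝ, 0 ≤ x → HasDerivAt (fun r => profile r - arcsin (k * (r / √(1 + r ^ 2))))
      ((√(1 - x ^ 2) / √2 - k / √(1 + (1 - k ^ 2) * x ^ 2)) / (1 + x ^ 2)) x := by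
    intro x hx
    have hq : 0 < 1 + x ^ 2 := by positivity
    have e0 : HasDerivAt (fun r : ℝ => 1 + r ^ 2) (2 * x) x := by
      simpa using ((hasDerivAt_id x).pow 2).const_add 1
    have e1 : HasDerivAt (fun r : ℝ => √(1 + r ^ 2)) (2 * x / (2 * √(1 + x ^ 2))) x :=
      e0.sqrt hq.ne'
    have e2 := ((hasDerivAt_id x).div e1 (by positivity)).const_mul k
    have hb := hlt x hx
    have hb0 : 0 ≤ x / √(1 + x ^ 2) := by positivity
    have hb1 : k * (x / √(1 + x ^ 2)) < 1 := by nlinarith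
    have hb2 : 0 ≤ k * (x / √(1 + x ^ 2)) := by positivity
    have e3 := (hasDerivAt_arcsin (x := k * (x / √(1 + x ^ 2))) (by linarith) hb1.ne).comp x e2
    refine ((hasDerivAt_profile x).sub e3).congr_deriv ?_
    have hsq : √(1 + x ^ 2) ^ 2 = 1 + x ^ 2 := sq_sqrt hq.le
    have hq' : 0 < √(1 + x ^ 2) := by positivity
    have hu : 0 < 1 + (1 - k ^ 2) * x ^ 2 := by
      nlinarith [mul_nonneg (sq_nonneg x) (show 0 ≤ 1 - k ^ 2 by nlinarith)]
    have hroot : √(1 - (k * (x / √(1 + x ^ 2))) ^ 2) =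
        √(1 + (1 - k ^ 2) * x ^ 2) / √(1 + x ^ 2) := by
      rw [← sqrt_div hu.le]; congr 1
      rw [mul_pow, div_pow, hsq]; field_simp; ring
    rw [hroot]
    have hu' : 0 < √(1 + (1 - k ^ 2) * x ^ 2) := by positivity
    simp only [id]
    field_simp
    rw [hsq]
    ring
  -- The derivative has the sign of √(1-x²)/√2 - k/√(1+(1-k²)x²), which is nonpositive because k ≥
  -- 1/√2 and the product of the two roots is at most 1.
  have anti : AntitoneOn (fun r => profile r - arcsin (k * (r / √(1 + r ^ 2)))) (Icc 0 1) := by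
    refine antitoneOn_of_deriv_nonpos (convex_Icc 0 1)
      (fun x hx => (hd x hx.1).continuousAt.continuousWithinAt)
      (fun x hx => (hd x (interior_subset hx).1).differentiableAt.differentiableWithinAt) ?_
    intro x hx
    have hx' := interior_subset hx
    rw [(hd x hx'.1).deriv]
    refine div_nonpos_of_nonpos_of_nonneg (sub_nonpos.2 ?_) (by positivity)
    have hu : 0 < 1 + (1 - k ^ 2) * x ^ 2 := by
      nlinarith [mul_nonneg (sq_nonneg x) (show 0 ≤ 1 - k ^ 2 by nlinarith)]
    refine le_trans ?_ (div_le_div_of_nonneg_right hk (by positivity))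
    rw [div_div, div_le_div_iff₀ hs (by positivity), one_mul, mul_left_comm]
    have hle : √(1 - x ^ 2) * √(1 + (1 - k ^ 2) * x ^ 2) ≤ 1 := by
      rw [← sqrt_mul (by nlinarith [hx'.1, hx'.2])]
      rw [sqrt_le_iff]
      refine ⟨by norm_num, ?_⟩
      nlinarith [sq_nonneg x, sq_nonneg k, mul_nonneg (sq_nonneg x) (sq_nonneg k),
        mul_nonneg (sq_nonneg x) (sq_nonneg x),
        mul_nonneg (mul_nonneg (sq_nonneg x) (sq_nonneg k))
          (show 0 ≤ 1 - x ^ 2 by nlinarith [hx'.1, hx'.2])]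
    nlinarith
  have := anti ⟨h0, h1⟩ (right_mem_Icc.2 zero_le_one) h1
  norm_num at this ⊢
  simpa using this

/-! ### Arguments of complex numbers in the right half-plane -/

theorem re_one_add_pos {z : ℂ} (h : ‖z‖ < 1) : 0 < (1 + z).re := by
  have := (abs_lt.1 ((Complex.abs_re_le_norm z).trans_lt h)).1
  simp only [Complex.add_re, Complex.one_re]; linarith

theorem one_add_ne_zero {z : ℂ} (h : ‖z‖ < 1) : 1 + z ≠ 0 := fun h0 => by
  have := re_one_add_pos h
  simp [h0] at this

theorem arg_mem_Ioo_of_re_pos {z : ℂ} (h : 0 < z.re) : z.arg ∈ Ioo (-(π / 2)) (π / 2) :=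
  abs_lt.1 (Complex.abs_arg_lt_pi_div_two_iff.2 (Or.inl h))

theorem arg_mul_of_re_pos {z w : ℂ} (hz : 0 < z.re) (hw : 0 < w.re) :
    (z * w).arg = z.arg + w.arg := by
  have h1 := arg_mem_Ioo_of_re_pos hz
  have h2 := arg_mem_Ioo_of_re_pos hw
  refine Complex.arg_mul (fun h => by simp [h] at hz) (fun h => by simp [h] at hw) ?_
  constructor <;> linarith [h1.1, h1.2, h2.1, h2.2]

theorem neg_arctan_le_arg {z : ℂ} {K : ℝ} (h : 0 < z.re) (hK : -(K * z.re) ≤ z.im) :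
    -arctan K ≤ z.arg := by
  have h1 := arg_mem_Ioo_of_re_pos h
  rw [← arctan_tan h1.1 h1.2, Complex.tan_arg, ← arctan_neg]
  refine arctan_le_arctan_iff.2 ?_
  rw [le_div_iff₀ h]; linarith

/-- The disc of radius k about 1 is seen from 0 under the half-angle arcsin k. -/
theorem neg_arcsin_le_arg_one_add {ξ : ℂ} {k : ℝ} (h : ‖ξ‖ ≤ k) (hk : k < 1) :
    -arcsin k ≤ (1 + ξ).arg := by
  have hk0 : 0 ≤ k := (norm_nonneg _).trans h
  have hre := re_one_add_pos (h.trans_lt hk)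
  have hs : 0 < √(1 - k ^ 2) := sqrt_pos.2 (by nlinarith)
  have hs2 : √(1 - k ^ 2) ^ 2 = 1 - k ^ 2 := sq_sqrt (by nlinarith)
  rw [arcsin_eq_arctan ⟨by linarith, hk⟩]
  refine neg_arctan_le_arg hre ?_
  have hn : ξ.re ^ 2 + ξ.im ^ 2 ≤ k ^ 2 := by
    have := Complex.sq_norm ξ
    rw [Complex.normSq_apply] at this
    nlinarith [norm_nonneg ξ]
  rw [div_mul_eq_mul_div, neg_le, le_div_iff₀ hs]
  refine abs_le_of_sq_le_sq' ?_ (by positivity) |>.2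
  rw [mul_pow, mul_pow, hs2]
  simp only [Complex.add_re, Complex.one_re, Complex.add_im, Complex.one_im, zero_add, neg_sq]
  nlinarith [sq_nonneg (ξ.re + k ^ 2),
    mul_le_mul_of_nonneg_left hn (show 0 ≤ 1 - k ^ 2 by nlinarith)]

theorem exists_arg_one_add_eq {k : ℝ} (h0 : 0 ≤ k) (hk : k < 1) :
    ∃ ξ : ℂ, ‖ξ‖ = k ∧ (1 + ξ).arg = -arcsin k := by
  have hs : 0 < √(1 - k ^ 2) := sqrt_pos.2 (by nlinarith)
  have hs2 : √(1 - k ^ 2) ^ 2 = 1 - k ^ 2 := sq_sqrt (by nlinarith)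
  -- The lower tangent from 0 touches the circle of radius k about 1 at (1-k²) - ik√(1-k²).
  refine ⟨⟨-k ^ 2, -(k * √(1 - k ^ 2))⟩, ?_, ?_⟩
  · rw [← sq_eq_sq₀ (norm_nonneg _) h0, Complex.sq_norm, Complex.normSq_mk]
    linear_combination k ^ 2 * hs2
  · have : (1 + ⟨-k ^ 2, -(k * √(1 - k ^ 2))⟩ : ℂ) = (√(1 - k ^ 2) : ℝ) *
        (Real.cos (-arcsin k) + Real.sin (-arcsin k) * Complex.I) := by
      rw [cos_neg, cos_arcsin, sin_neg, sin_arcsin (by linarith) hk.le]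
      apply Complex.ext
      · simp; linear_combination -hs2
      · simp; ring
    rw [this, Complex.ofReal_cos, Complex.ofReal_sin, Complex.arg_mul_cos_add_sin_mul_I hs]
    constructor
    · linarith [arcsin_le_pi_div_two k, pi_pos]
    · linarith [neg_pi_div_two_le_arcsin k, pi_pos]

/-- The quotient is an automorphism of the unit disc: the squares differ by (1-|X|²)(1-|δ|²). -/
theorem norm_add_conj_lt {X δ : ℂ} (hX : ‖X‖ < 1) (hδ : ‖δ‖ < 1) :
    ‖X + conj δ‖ < ‖1 + X * δ‖ := by
  rw [← sq_lt_sq₀ (norm_nonneg _) (norm_nonneg _)]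
  have h1 : 0 < (1 - ‖X‖ ^ 2) * (1 - ‖δ‖ ^ 2) :=
    mul_pos (by nlinarith [norm_nonneg X]) (by nlinarith [norm_nonneg δ])
  simp only [Complex.sq_norm, Complex.normSq_apply, Complex.add_re, Complex.add_im, Complex.mul_re,
    Complex.mul_im, Complex.one_re, Complex.one_im, Complex.conj_re, Complex.conj_im] at h1 ⊢
  nlinarith

/-- For fixed `P` and `Q` some `Y` of norm `c` brings `arg (1 + Y Q / P)` down to its bound. -/
theorem exists_arg_one_add_mul_div_eq {c : ℝ} (P Q : ℂ) (hc : 0 ≤ c)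
    (h : c * (‖Q‖ / ‖P‖) < 1) :
    ∃ Y : ℂ, ‖Y‖ = c ∧ (1 + Y * Q / P).arg = -arcsin (c * (‖Q‖ / ‖P‖)) := by
  by_cases hQ : Q / P = 0
  · refine ⟨c, by simp [abs_of_nonneg hc], ?_⟩
    rw [mul_div_assoc, ← norm_div, hQ]; simp
  · obtain ⟨ξ, h1, h2⟩ := exists_arg_one_add_eq (mul_nonneg hc (by positivity)) h
    refine ⟨ξ / (Q / P), ?_, ?_⟩
    · rw [norm_div, h1, norm_div]
      refine mul_div_cancel_right₀ _ ?_
      rw [← norm_div]; exact norm_ne_zero_iff.2 hQ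
    · rw [mul_div_assoc, div_mul_cancel₀ _ hQ, h2]

/-- Both sides are the argument of 1 + Xδ + YX + Yε. The choice of factorisation decides which
variable stands alone in the last factor. -/
theorem arg_one_add_mul_swap {X Y δ ε : ℂ} (hX : ‖X‖ < 1) (hY : ‖Y‖ < 1) (hδ : ‖δ‖ < 1)
    (hε : ‖ε‖ < 1) (h1 : ‖Y * (X + ε) / (1 + X * δ)‖ < 1)
    (h2 : ‖X * (Y + δ) / (1 + Y * ε)‖ < 1) :
    (1 + X * δ).arg + (1 + Y * (X + ε) / (1 + X * δ)).arg =
      (1 + Y * ε).arg + (1 + X * (Y + δ) / (1 + Y * ε)).arg := by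
  have a1 : ‖X * δ‖ < 1 := by rw [norm_mul]; nlinarith [norm_nonneg X, norm_nonneg δ]
  have a2 : ‖Y * ε‖ < 1 := by rw [norm_mul]; nlinarith [norm_nonneg Y, norm_nonneg ε]
  have n1 := one_add_ne_zero a1
  have n2 := one_add_ne_zero a2
  rw [← arg_mul_of_re_pos (re_one_add_pos a1) (re_one_add_pos h1),
    ← arg_mul_of_re_pos (re_one_add_pos a2) (re_one_add_pos h2)]
  congr 1
  field_simp
  ring

theorem norm_mul_div_lt_one {Y Q P : ℂ} (hY : ‖Y‖ < 1) (h : ‖Q‖ < ‖P‖) : ‖Y * Q / P‖ < 1 := by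
  have hP : 0 < ‖P‖ := (norm_nonneg _).trans_lt h
  rw [norm_div, norm_mul, div_lt_one hP]
  nlinarith [norm_nonneg Y, norm_nonneg Q]

/-! ### The extremal problem for two steps -/

theorem pi_div_three_le_arctan : π / 3 ≤ arctan (3 * √(3 / 5)) := by
  have h : -(π / 2) < π / 3 ∧ π / 3 < π / 2 := by constructor <;> linarith [pi_pos]
  rw [← arctan_tan h.1 h.2, tan_pi_div_three]
  refine arctan_le_arctan_iff.2 ?_
  refine sqrt_le_iff.2 ⟨by positivity, ?_⟩
  rw [mul_pow, sq_sqrt (by norm_num)]; norm_num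

theorem neg_le_hexagon_im {p q : ℂ} (hp : ‖p‖ = 1) (hq : ‖q‖ = 1) :
    0 < (2 + p + q + p * q).re ∧
      -(3 * √(3 / 5) * (2 + p + q + p * q).re) ≤ (2 + p + q + p * q).im := by
  obtain ⟨s, d, rfl, rfl⟩ : ∃ s d : ℝ, p = Complex.exp ((s + d : ℝ) * Complex.I) ∧
      q = Complex.exp ((s - d : ℝ) * Complex.I) := by
    refine ⟨(p.arg + q.arg) / 2, (p.arg - q.arg) / 2, ?_, ?_⟩
    · have := Complex.norm_mul_exp_arg_mul_I p
      rw [hp, Complex.ofReal_one, one_mul] at this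
      refine this.symm.trans ?_
      congr 2; push_cast; ring
    · have := Complex.norm_mul_exp_arg_mul_I q
      rw [hq, Complex.ofReal_one, one_mul] at this
      refine this.symm.trans ?_
      congr 2; push_cast; ring
  set K := 3 * √(3 / 5) with hK
  have hK0 : 0 ≤ K := by positivity
  have hK2 : K ^ 2 = 27 / 5 := by rw [hK, mul_pow, sq_sqrt (by norm_num)]; norm_num
  have hc2 := sin_sq_add_cos_sq s
  rw [← Complex.exp_add, ← add_mul, ← Complex.ofReal_add]
  simp only [Complex.add_re, Complex.add_im, Complex.exp_ofReal_mul_I_re,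
    Complex.exp_ofReal_mul_I_im, Complex.re_ofNat, Complex.im_ofNat]
  have hsum : s + d + (s - d) = 2 * s := by ring
  rw [hsum, cos_add, cos_sub, sin_add, sin_sub, cos_two_mul, sin_two_mul]
  have he1 := neg_one_le_cos d
  have he2 := cos_le_one d
  generalize cos d = e at *
  have hc1 := neg_one_le_cos s
  have hc3 := cos_le_one s
  generalize cos s = c at *
  generalize sin s = S at *
  have hS : S ^ 2 = 1 - c ^ 2 := by linarith
  -- With p, q = e^{i(s±d)} the inequality is affine in e = cos d, so only e = ±1 matters; `key`
  -- covers both, with (x, T) = ±(cos s, sin s).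
  have key : ∀ x : ℝ, |x| ≤ 1 → x ^ 2 + S ^ 2 = 1 → ∀ T : ℝ, T ^ 2 = S ^ 2 →
      0 ≤ K * (1 + 2 * x + 2 * x ^ 2) + 2 * T * (1 + x) := by
    intro x _ hx T hT
    have h1 : 0 ≤ K * (1 + 2 * x + 2 * x ^ 2) :=
      mul_nonneg hK0 (by nlinarith [sq_nonneg (1 + x), sq_nonneg x])
    have h2 : (2 * T * (1 + x)) ^ 2 ≤ (K * (1 + 2 * x + 2 * x ^ 2)) ^ 2 := by
      rw [mul_pow K, hK2]
      have : T ^ 2 = 1 - x ^ 2 := by linarith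
      have e : (2 * T * (1 + x)) ^ 2 = 4 * (1 - x ^ 2) * (1 + x) ^ 2 := by rw [← this]; ring
      rw [e]
      -- The product is five times the difference of the squares; its double root x = -1/4 is the
      -- extremal cosine and fixes the constant 27/5.
      have : 0 ≤ (4 * x + 1) ^ 2 * (8 * x ^ 2 + 12 * x + 7) :=
        mul_nonneg (sq_nonneg _) (by nlinarith [sq_nonneg (4 * x + 3)])
      nlinarith
    linarith [(abs_le_of_sq_le_sq' h2 h1).1]
  have k1 := key c (abs_le.2 ⟨hc1, hc3⟩) (by linarith) S rfl
  have k2 := key (-c) (abs_le.2 ⟨by linarith, by linarith⟩) (by linarith) (-S) (by ring)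
  constructor
  · nlinarith [mul_nonneg (by linarith : 0 ≤ 1 + e) (sq_nonneg (1 + 2 * c)),
      mul_nonneg (by linarith : 0 ≤ 1 - e) (sq_nonneg (1 - 2 * c)), sq_nonneg c]
  · nlinarith [mul_nonneg (by linarith : 0 ≤ 1 + e) k1, mul_nonneg (by linarith : 0 ≤ 1 - e) k2]

/-- With p = 2YX̄ and q = 2δX, both of norm 1, |X|² = 1/2 gives pq = 2δY, so twice the sum is 2 + p
+ q + pq. -/
theorem neg_arctan_le_arg_hexagon {X Y δ : ℂ} (hX : ‖X‖ = 1 / √2) (hY : ‖Y‖ = 1 / √2)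
    (hδ : ‖δ‖ = 1 / √2) :
    -arctan (3 * √(3 / 5)) ≤ (1 + Y * conj X + δ * X + δ * Y).arg := by
  have h2 : √2 * √2 = 2 := mul_self_sqrt (by norm_num)
  have hh : (1 / √2) * (1 / √2) = 1 / 2 := by rw [div_mul_div_comm, h2, one_mul]
  have hn : ∀ z w : ℂ, ‖z‖ = 1 / √2 → ‖w‖ = 1 / √2 → ‖2 * (z * w)‖ = 1 := fun z w hz hw => by
    rw [norm_mul, norm_mul, hz, hw, hh]; norm_num
  have hw := neg_le_hexagon_im (hn Y (conj X) hY (by simpa using hX)) (hn δ X hδ hX)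
  have hXX : conj X * X = 1 / 2 := by
    rw [mul_comm, Complex.mul_conj, Complex.normSq_eq_norm_sq, hX, sq, hh]; norm_num
  have e : 2 + 2 * (Y * conj X) + 2 * (δ * X) + 2 * (Y * conj X) * (2 * (δ * X)) =
      (2 : ℝ) * (1 + Y * conj X + δ * X + δ * Y) := by
    push_cast
    linear_combination 4 * Y * δ * hXX
  rw [e, Complex.re_ofReal_mul, Complex.im_ofReal_mul] at hw
  exact neg_arctan_le_arg (by linarith [hw.1]) (by linarith [hw.2])

theorem one_div_sqrt_two_lt_one : 1 / √2 < 1 := by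
  rw [div_lt_one (by positivity)]
  exact lt_sqrt_of_sq_lt (by norm_num)

theorem div_sqrt_le {r : ℝ} (h0 : 0 ≤ r) (h1 : r ≤ 1) : r / √(1 + r ^ 2) ≤ 1 / √2 := by
  rw [div_le_div_iff₀ (by positivity) (by positivity), one_mul]
  refine le_sqrt_of_sq_le ?_
  rw [mul_pow, sq_sqrt (by norm_num)]
  nlinarith

theorem arcsin_half : arcsin (1 / √2 * (1 / √2)) = π / 6 := by
  rw [div_mul_div_comm, mul_self_sqrt (by norm_num), one_mul, ← sin_pi_div_six]
  exact arcsin_sin (by linarith [pi_pos]) (by linarith [pi_pos])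

theorem profile_sub_arcsin_ge_of_le {k r : ℝ} (hk : k ≤ 1 / √2) (h0 : 0 ≤ r) (h1 : r ≤ 1) :
    profile 1 - π / 6 ≤ profile r - arcsin (k * (r / √(1 + r ^ 2))) := by
  have h := profile_sub_arcsin_ge le_rfl one_div_sqrt_two_lt_one h0 h1
  rw [arcsin_half] at h
  have : arcsin (k * (r / √(1 + r ^ 2))) ≤ arcsin (1 / √2 * (r / √(1 + r ^ 2))) :=
    arcsin_le_arcsin (mul_le_mul_of_nonneg_right hk (by positivity))
  linarith

/-- The gain in time over two steps that start at radius at most `1`. -/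
theorem two_step_gain {X Y δ : ℂ} {r s : ℝ} (hX : ‖X‖ ≤ 1 / √2) (hr0 : 0 ≤ r) (hr1 : r ≤ 1)
    (hs0 : 0 ≤ s) (hs1 : s ≤ 1) (hδ : ‖δ‖ = r / √(1 + r ^ 2)) (hY : ‖Y‖ = s / √(1 + s ^ 2)) :
    2 * profile 1 - arctan (3 * √(3 / 5)) ≤ profile r + profile s + (1 + X * δ).arg
      + (1 + Y * (X + conj δ) / (1 + X * δ)).arg := by
  have hlt := one_div_sqrt_two_lt_one
  have hc0 : 0 ≤ 1 / √2 := by positivity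
  have hδ' : ‖δ‖ ≤ 1 / √2 := hδ.trans_le (div_sqrt_le hr0 hr1)
  have hY' : ‖Y‖ ≤ 1 / √2 := hY.trans_le (div_sqrt_le hs0 hs1)
  have hδ1 := hδ'.trans_lt hlt
  have hY1 := hY'.trans_lt hlt
  have hX1 := hX.trans_lt hlt
  have hcδ : ‖conj δ‖ < 1 := by simpa using hδ1
  have comm : ∀ Y : ℂ, ‖Y + δ‖ = ‖Y + conj (conj δ)‖ := fun Y => by simp
  -- X carries no profile term. Isolated in the last factor, it can be replaced by an X' of norm
  -- 1/√2 that attains the lower bound for that factor.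
  wlog hXn : ‖X‖ = 1 / √2 generalizing X
  · have hA : ‖Y + δ‖ < ‖1 + Y * conj δ‖ := by rw [comm]; exact norm_add_conj_lt hY1 hcδ
    have hP : 0 < ‖1 + Y * conj δ‖ := (norm_nonneg _).trans_lt hA
    have hk : ‖Y + δ‖ / ‖1 + Y * conj δ‖ < 1 := (div_lt_one hP).2 hA
    have hk0 : 0 ≤ ‖Y + δ‖ / ‖1 + Y * conj δ‖ := by positivity
    obtain ⟨X', hX'1, hX'2⟩ := exists_arg_one_add_mul_div_eq (1 + Y * conj δ) (Y + δ) hc0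
      (mul_lt_one_of_nonneg_of_lt_one_left hc0 hlt hk.le)
    have hX'lt := hX'1.trans_lt hlt
    have hmain := this hX'1.le hX'lt hX'1
    have hle := neg_arcsin_le_arg_one_add (ξ := X * (Y + δ) / (1 + Y * conj δ))
      (k := 1 / √2 * (‖Y + δ‖ / ‖1 + Y * conj δ‖))
      (by rw [norm_div, norm_mul, mul_div_assoc]; exact mul_le_mul_of_nonneg_right hX hk0)
      (mul_lt_one_of_nonneg_of_lt_one_left hc0 hlt hk.le)
    have s1 := arg_one_add_mul_swap hX1 hY1 hδ1 hcδ
      (norm_mul_div_lt_one hY1 (norm_add_conj_lt hX1 hδ1)) (norm_mul_div_lt_one hX1 hA)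
    have s2 := arg_one_add_mul_swap hX'lt hY1 hδ1 hcδ
      (norm_mul_div_lt_one hY1 (norm_add_conj_lt hX'lt hδ1)) (norm_mul_div_lt_one hX'lt hA)
    linarith
  · set k := ‖X + conj δ‖ / ‖1 + X * δ‖ with hk
    have hA := norm_add_conj_lt hX1 hδ1
    have hP : 0 < ‖1 + X * δ‖ := (norm_nonneg _).trans_lt hA
    have hk0 : 0 ≤ k := by positivity
    have hk1 : k < 1 := (div_lt_one hP).2 hA
    have hYk : ‖Y‖ * k < 1 :=
      mul_lt_one_of_nonneg_of_lt_one_left (norm_nonneg _) hY1 hk1.le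
    have hB := neg_arcsin_le_arg_one_add (ξ := Y * (X + conj δ) / (1 + X * δ))
      (k := k * (s / √(1 + s ^ 2))) (by rw [norm_div, norm_mul, mul_div_assoc, ← hY, mul_comm])
      (by rw [← hY, mul_comm]; exact hYk)
    have hpi := pi_div_three_le_arctan
    have hthree : ∀ {U V : ℂ}, ‖U‖ ≤ 1 / √2 → ‖V‖ ≤ 1 / √2 → -(π / 6) ≤ (1 + U * V).arg := by
      intro U V hU hV
      rw [← arcsin_half]
      refine neg_arcsin_le_arg_one_add ?_ (mul_lt_one_of_nonneg_of_lt_one_left hc0 hlt hlt.le)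
      rw [norm_mul]
      exact mul_le_mul hU hV (norm_nonneg _) hc0
    have hsixth : ∀ {c : ℝ} {r : ℝ}, c ≤ 1 / √2 → 0 ≤ r → r ≤ 1 → profile 1 - π / 6 ≤
        profile r - arcsin (c * (r / √(1 + r ^ 2))) := profile_sub_arcsin_ge_of_le
    -- The leverage k multiplies ‖Y‖. Below 1/√2, each of the two steps contributes at least
    -- `profile 1` - π/6.
    rcases lt_or_ge k (1 / √2) with hlo | hhi
    · have h1 := hsixth hlo.le hs0 hs1
      have h2 := hsixth hXn.le hr0 hr1
      have h3 := neg_arcsin_le_arg_one_add (ξ := X * δ) (k := ‖X‖ * (r / √(1 + r ^ 2)))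
        (by rw [norm_mul, hδ]) (by
          rw [← hδ]; exact mul_lt_one_of_nonneg_of_lt_one_left (norm_nonneg _) hX1 hδ1.le)
      linarith
    have hconj : ‖conj X + δ‖ = ‖X + conj δ‖ := by
      rw [← Complex.norm_conj]; simp
    -- The minimum over Y depends only on the norm of its cofactor, so X + δ̄ may be replaced by its
    -- conjugate. The new sum 1 + Xδ + Y'X̄ + Y'δ contains no δ̄, so δ can be isolated next.
    obtain ⟨Y', hY'1, hY'2⟩ := exists_arg_one_add_mul_div_eq (1 + X * δ) (conj X + δ) hc0
      (by rw [hconj, ← hk]; exact mul_lt_one_of_nonneg_of_lt_one_left hc0 hlt hk1.le)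
    rw [hconj, ← hk] at hY'2
    have h1 := profile_sub_arcsin_ge hhi hk1 hs0 hs1
    rw [mul_comm k (1 / √2)] at h1
    have hY'lt := hY'1.trans_lt hlt
    have hcX : ‖conj X‖ < 1 := by simpa using hX1
    have hcX' : ‖conj X‖ = 1 / √2 := by simpa using hXn
    have hC : ‖X + Y'‖ < ‖1 + Y' * conj X‖ := by
      have := norm_add_conj_lt hY'lt hcX
      rwa [Complex.conj_conj, add_comm] at this
    set k' := ‖X + Y'‖ / ‖1 + Y' * conj X‖ with hk'
    have hP' : 0 < ‖1 + Y' * conj X‖ := (norm_nonneg _).trans_lt hC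
    have hk'0 : 0 ≤ k' := by positivity
    have hk'1 : k' < 1 := (div_lt_one hP').2 hC
    have hsw := arg_one_add_mul_swap (ε := conj X) hδ1 hY'lt hX1 hcX
      (by rw [mul_comm δ X, add_comm δ]
          exact norm_mul_div_lt_one hY'lt (hconj.trans_lt hA))
      (norm_mul_div_lt_one hδ1 (by rwa [add_comm]))
    rw [mul_comm δ X, add_comm δ, add_comm Y' X] at hsw
    have hD := neg_arcsin_le_arg_one_add (ξ := δ * (X + Y') / (1 + Y' * conj X))
      (k := k' * (r / √(1 + r ^ 2))) (by rw [norm_div, norm_mul, mul_div_assoc, ← hδ, mul_comm])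
      (by
        rw [← hδ, mul_comm]
        exact mul_lt_one_of_nonneg_of_lt_one_left (norm_nonneg _) hδ1 hk'1.le)
    -- The same dichotomy for δ; if k' is large, all three norms become 1/√2 and the hexagon bound
    -- applies.
    rcases lt_or_ge k' (1 / √2) with hlo | hhi'
    · have h2 := hsixth hlo.le hr0 hr1
      have h3 := hthree hY'1.le hcX'.le
      linarith
    · have h2 := profile_sub_arcsin_ge hhi' hk'1 hr0 hr1
      rw [mul_comm k' (1 / √2)] at h2
      obtain ⟨δ', hδ'1, hδ'2⟩ := exists_arg_one_add_mul_div_eq (1 + Y' * conj X) (X + Y') hc0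
        (by rw [← hk']; exact mul_lt_one_of_nonneg_of_lt_one_left hc0 hlt hk'1.le)
      rw [← hk'] at hδ'2
      have h3 := neg_arctan_le_arg_hexagon hXn hY'1 hδ'1
      have hYX : ‖Y' * conj X‖ < 1 := by
        rw [norm_mul]; exact mul_lt_one_of_nonneg_of_lt_one_left (norm_nonneg _) hY'lt hcX.le
      have h4 := arg_mul_of_re_pos (re_one_add_pos hYX)
        (re_one_add_pos (norm_mul_div_lt_one (hδ'1.trans_lt hlt) hC))
      have e : (1 + Y' * conj X) * (1 + δ' * (X + Y') / (1 + Y' * conj X)) =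
          1 + Y' * conj X + δ' * X + δ' * Y' := by
        have := one_add_ne_zero hYX
        field_simp
        ring
      rw [e] at h4
      linarith

/-! ### Multiplication in the universal cover of SU(1,1) -/

/-- A pair `(α, b)` stands for the element `(a b; conj b, conj a)` of `SU(1,1)`, together with the
lift `α` of the argument of its entry `a = amp α b`. -/
def amp (α : ℝ) (b : ℂ) : ℂ := (√(1 + ‖b‖ ^ 2) : ℝ) * Complex.exp (α * Complex.I)

theorem norm_amp (α : ℝ) (b : ℂ) : ‖amp α b‖ = √(1 + ‖b‖ ^ 2) := by
  rw [amp, norm_mul, Complex.norm_exp_ofReal_mul_I, mul_one, Complex.norm_real, norm_eq_abs,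
    abs_of_nonneg (sqrt_nonneg _)]

theorem norm_amp_sq (α : ℝ) (b : ℂ) : ‖amp α b‖ ^ 2 = 1 + ‖b‖ ^ 2 := by
  rw [norm_amp, sq_sqrt (by positivity)]

theorem norm_amp_pos (α : ℝ) (b : ℂ) : 0 < ‖amp α b‖ := by
  rw [norm_amp]; positivity

theorem amp_ne_zero (α : ℝ) (b : ℂ) : amp α b ≠ 0 := norm_pos_iff.1 (norm_amp_pos α b)

theorem amp_mul_conj (α : ℝ) (b : ℂ) : amp α b * conj (amp α b) = 1 + b * conj b := by
  rw [Complex.mul_conj, Complex.mul_conj, Complex.normSq_eq_norm_sq, Complex.normSq_eq_norm_sq,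
    norm_amp_sq]
  push_cast; ring

theorem eq_amp {a b : ℂ} {α : ℝ} (h : ‖a‖ ^ 2 = 1 + ‖b‖ ^ 2)
    (ha : a = ‖a‖ * Complex.exp (α * Complex.I)) : a = amp α b := by
  rw [amp, ← h, sqrt_sq (norm_nonneg _)]; exact ha

theorem amp_zero : amp 0 0 = 1 := by simp [amp]

theorem amp_neg_neg (α : ℝ) (b : ℂ) : amp (-α) (-b) = conj (amp α b) := by
  simp [amp, ← Complex.exp_conj]

theorem amp_neg_conj (α : ℝ) (b : ℂ) : amp (-α) (conj b) = conj (amp α b) := by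
  simp [amp, ← Complex.exp_conj]

theorem norm_div_amp (α : ℝ) (b : ℂ) : ‖b / amp α b‖ = ‖b‖ / √(1 + ‖b‖ ^ 2) := by
  rw [norm_div, norm_amp]

theorem norm_div_amp_lt_one (α : ℝ) (b : ℂ) : ‖b / amp α b‖ < 1 := by
  rw [norm_div_amp, div_lt_one (by positivity)]
  exact lt_sqrt_of_sq_lt (by linarith)

theorem norm_mul_conj_div_lt_one (α₀ : ℝ) (b₀ : ℂ) (α : ℝ) (b : ℂ) :
    ‖b₀ * conj b / (amp α₀ b₀ * amp α b)‖ < 1 := by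
  have h1 := norm_div_amp_lt_one α₀ b₀
  have h2 := norm_div_amp_lt_one α b
  rw [norm_div] at h1 h2
  rw [norm_div, norm_mul, norm_mul, Complex.norm_conj, mul_div_mul_comm]
  exact mul_lt_one_of_nonneg_of_lt_one_left (by positivity) h1 h2.le

/-- The lifted argument of a product. -/
def mulTime (α₀ : ℝ) (b₀ : ℂ) (α : ℝ) (b : ℂ) : ℝ :=
  α₀ + α + (1 + b₀ * conj b / (amp α₀ b₀ * amp α b)).arg

/-- The off-diagonal entry of a product. -/
def mulShift (α₀ : ℝ) (b₀ : ℂ) (α : ℝ) (b : ℂ) : ℂ := amp α₀ b₀ * b + b₀ * conj (amp α b)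

/-- The entry is a₀a(1 + b₀b̄/(a₀a)). The last factor lies in the right half-plane, so its principal
argument gives a continuous lift. -/
theorem amp_mul (α₀ : ℝ) (b₀ : ℂ) (α : ℝ) (b : ℂ) :
    amp (mulTime α₀ b₀ α b) (mulShift α₀ b₀ α b) = amp α₀ b₀ * amp α b + b₀ * conj b := by
  have h0 := amp_ne_zero α₀ b₀
  have h1 := amp_ne_zero α b
  symm
  apply eq_amp
  · have e0 := amp_mul_conj α₀ b₀
    have e1 := amp_mul_conj α b
    rw [mulShift]
    apply Complex.ofReal_injective
    push_cast
    rw [← Complex.mul_conj', ← Complex.mul_conj']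
    simp only [map_add, map_mul, Complex.conj_conj]
    linear_combination (amp α b * conj (amp α b) - b * conj b) * e0 + e1
  · set z := 1 + b₀ * conj b / (amp α₀ b₀ * amp α b) with hz
    have e : amp α₀ b₀ * amp α b + b₀ * conj b = amp α₀ b₀ * amp α b * z := by
      rw [hz]; field_simp
    have hze := Complex.norm_mul_exp_arg_mul_I z
    rw [e, norm_mul, norm_mul, norm_amp, norm_amp, mulTime, ← hz]
    conv_lhs => rw [← hze]
    rw [amp, amp]
    push_cast
    rw [add_mul, add_mul, Complex.exp_add, Complex.exp_add]
    ring

theorem mulTime_neg_neg_self (α : ℝ) (b : ℂ) : mulTime (-α) (-b) α b = 0 := by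
  have h : 1 + -b * conj b / (amp (-α) (-b) * amp α b) = ((1 + ‖b‖ ^ 2)⁻¹ : ℝ) := by
    have hn : (1 + (‖b‖ : ℂ) ^ 2) ≠ 0 := by
      have : (1 + ‖b‖ ^ 2) ≠ 0 := by positivity
      exact_mod_cast this
    rw [amp_neg_neg, mul_comm (conj _), amp_mul_conj, neg_mul, Complex.mul_conj']
    push_cast
    field_simp
    ring
  rw [mulTime, h, Complex.arg_ofReal_of_nonneg (by positivity)]
  ring

theorem mulShift_neg_neg_self (α : ℝ) (b : ℂ) : mulShift (-α) (-b) α b = 0 := by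
  rw [mulShift, amp_neg_neg]; ring

theorem mulShift_mul_neg_neg (α₀ : ℝ) (b₀ : ℂ) (α : ℝ) (b : ℂ) :
    mulShift α₀ b₀ (mulTime (-α₀) (-b₀) α b) (mulShift (-α₀) (-b₀) α b) = b := by
  rw [mulShift, amp_mul, mulShift, amp_neg_neg]
  simp only [map_add, map_mul, map_neg, Complex.conj_conj]
  linear_combination b * amp_mul_conj α₀ b₀

/-- The two correction factors multiply to 1/(1+|b₀|²) > 0, and both lie in the right half-plane, so
their arguments cancel with no multiple of 2π left over. -/
theorem mulTime_mul_neg_neg (α₀ : ℝ) (b₀ : ℂ) (α : ℝ) (b : ℂ) :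
    mulTime α₀ b₀ (mulTime (-α₀) (-b₀) α b) (mulShift (-α₀) (-b₀) α b) = α := by
  have h1 := norm_mul_conj_div_lt_one (-α₀) (-b₀) α b
  have h2 := norm_mul_conj_div_lt_one α₀ b₀ (mulTime (-α₀) (-b₀) α b) (mulShift (-α₀) (-b₀) α b)
  have hA := amp_ne_zero (mulTime (-α₀) (-b₀) α b) (mulShift (-α₀) (-b₀) α b)
  have h3 := arg_mul_of_re_pos (re_one_add_pos h1) (re_one_add_pos h2)
  have ha := amp_ne_zero α b
  have h0 := amp_ne_zero α₀ b₀
  have hc0 : conj (amp α₀ b₀) ≠ 0 := (map_ne_zero _).2 h0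
  have e : (1 + -b₀ * conj b / (amp (-α₀) (-b₀) * amp α b)) *
      (1 + b₀ * conj (mulShift (-α₀) (-b₀) α b) /
        (amp α₀ b₀ * amp (mulTime (-α₀) (-b₀) α b) (mulShift (-α₀) (-b₀) α b))) =
      ((1 + ‖b₀‖ ^ 2)⁻¹ : ℝ) := by
    have hn : (1 + (‖b₀‖ : ℂ) ^ 2) ≠ 0 := by
      have : (1 + ‖b₀‖ ^ 2) ≠ 0 := by positivity
      exact_mod_cast this
    have key := amp_mul_conj α₀ b₀
    rw [amp_mul] at hA ⊢
    rw [mulShift]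
    rw [amp_neg_neg] at hA ⊢
    simp only [map_add, map_mul, map_neg, Complex.conj_conj]
    set a₀ := amp α₀ b₀
    set a := amp α b
    have e1 : 1 + -b₀ * conj b / (conj a₀ * a) = (conj a₀ * a + -b₀ * conj b) / (conj a₀ * a) := by
      field_simp
    have e2 : 1 + b₀ * (a₀ * conj b + -conj b₀ * a) / (a₀ * (conj a₀ * a + -b₀ * conj b)) =
        a / (a₀ * (conj a₀ * a + -b₀ * conj b)) := by
      have hne := mul_ne_zero h0 hA
      rw [eq_div_iff hne, add_mul, div_mul_cancel₀ _ hne]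
      linear_combination a * key
    rw [e1, e2, div_mul_div_comm]
    push_cast
    rw [← Complex.mul_conj', ← key, inv_eq_one_div, div_eq_div_iff (by positivity) (by positivity)]
    ring
  rw [e, Complex.arg_ofReal_of_nonneg (by positivity)] at h3
  conv_lhs => rw [mulTime]
  linarith [show mulTime (-α₀) (-b₀) α b =
    -α₀ + α + (1 + -b₀ * conj b / (amp (-α₀) (-b₀) * amp α b)).arg from rfl]

/-! ### Flows and their symmetries -/

/-- The rotating planar velocity of a flow. -/
def shear (η : ℝ) (σ : ℂ) (t : ℝ) : ℂ := σ * Complex.exp ((2 * η * t : ℝ) * Complex.I)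

theorem norm_shear (η : ℝ) (σ : ℂ) (t : ℝ) : ‖shear η σ t‖ = ‖σ‖ := by
  rw [shear, norm_mul, Complex.norm_exp_ofReal_mul_I, mul_one]

theorem hasDerivAt_shear (η : ℝ) (σ : ℂ) (t : ℝ) :
    HasDerivAt (shear η σ) (2 * η * Complex.I * shear η σ t) t := by
  have h : HasDerivAt (fun t : ℝ => ((2 * η * t : ℝ) : ℂ) * Complex.I)
      ((2 * η * 1 : ℝ) * Complex.I) t :=
    (((hasDerivAt_id t).const_mul (2 * η)).ofReal_comp).mul_const _
  refine (h.cexp.const_mul σ).congr_deriv ?_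
  rw [shear]; push_cast; ring

/-- The geodesic equations in group form. -/
structure IsFlow (η : ℝ) (σ : ℂ) (α : ℝ → ℝ) (b : ℝ → ℂ) : Prop where
  nonneg : 0 ≤ η
  cone : ‖σ‖ ^ 2 ≤ 2 * η ^ 2
  hasDeriv_time : ∀ t ∈ Icc (0 : ℝ) 1, HasDerivWithinAt α
    (η + (b t * conj (shear η σ t) / amp (α t) (b t)).im) (Icc 0 1) t
  hasDeriv_shift : ∀ t ∈ Icc (0 : ℝ) 1, HasDerivWithinAt b
    (amp (α t) (b t) * shear η σ t - η * Complex.I * b t) (Icc 0 1) t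

theorem hasDerivWithinAt_conj {f : ℝ → ℂ} {f' : ℂ} {s : Set ℝ} {t : ℝ}
    (h : HasDerivWithinAt f f' s t) : HasDerivWithinAt (fun t => conj (f t)) (conj f') s t :=
  h.star

theorem hasDerivWithinAt_im {f : ℝ → ℂ} {f' : ℂ} {s : Set ℝ} {t : ℝ}
    (h : HasDerivWithinAt f f' s t) : HasDerivWithinAt (fun t => (f t).im) f'.im s t :=
  Complex.imCLM.hasFDerivAt.comp_hasDerivWithinAt t h

theorem hasDerivWithinAt_re {f : ℝ → ℂ} {f' : ℂ} {s : Set ℝ} {t : ℝ}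
    (h : HasDerivWithinAt f f' s t) : HasDerivWithinAt (fun t => (f t).re) f'.re s t :=
  Complex.reCLM.hasFDerivAt.comp_hasDerivWithinAt t h

namespace IsFlow

variable {η : ℝ} {σ : ℂ} {α : ℝ → ℝ} {b : ℝ → ℂ}

theorem hasDeriv_norm_sq (h : IsFlow η σ α b) {t : ℝ} (ht : t ∈ Icc (0 : ℝ) 1) :
    HasDerivWithinAt (fun t => ‖b t‖ ^ 2)
      (2 * (conj (b t) * amp (α t) (b t) * shear η σ t).re) (Icc 0 1) t := by
  refine (h.hasDeriv_shift t ht).norm_sq.congr_deriv ?_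
  rw [Complex.inner]
  congr 1
  have : conj (b t) * (η * Complex.I * b t) = ((η * ‖b t‖ ^ 2 : ℝ) : ℂ) * Complex.I := by
    have := Complex.conj_mul' (b t)
    push_cast
    linear_combination η * Complex.I * this
  rw [mul_comm, mul_sub, this, Complex.sub_re, Complex.re_ofReal_mul, Complex.I_re]
  ring_nf

/-- Together with `hasDeriv_shift` this is the matrix equation g' = gX, which makes left invariance
visible. -/
theorem hasDeriv_amp (h : IsFlow η σ α b) {t : ℝ} (ht : t ∈ Icc (0 : ℝ) 1) :
    HasDerivWithinAt (fun t => amp (α t) (b t))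
      (η * Complex.I * amp (α t) (b t) + b t * conj (shear η σ t)) (Icc 0 1) t := by
  have hq : 0 < 1 + ‖b t‖ ^ 2 := by positivity
  have h1 := ((h.hasDeriv_norm_sq ht).const_add 1).sqrt hq.ne'
  have h2 := ((h.hasDeriv_time t ht).ofReal_comp.mul_const Complex.I).cexp
  refine (h1.ofReal_comp.mul h2).congr_deriv ?_
  set X := b t * conj (shear η σ t) / amp (α t) (b t) with hX
  have hXa : b t * conj (shear η σ t) = X * amp (α t) (b t) := by
    rw [hX, div_mul_cancel₀ _ (amp_ne_zero _ _)]
  have hre : (conj (b t) * amp (α t) (b t) * shear η σ t).re = (1 + ‖b t‖ ^ 2) * X.re := by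
    have : conj (b t) * amp (α t) (b t) * shear η σ t = ((1 + ‖b t‖ ^ 2 : ℝ) : ℂ) * conj X := by
      rw [← norm_amp_sq (α t) (b t)]
      have h3 := congrArg conj hXa
      simp only [map_mul, Complex.conj_conj] at h3
      push_cast
      rw [← Complex.mul_conj']
      linear_combination amp (α t) (b t) * h3
    rw [this, Complex.re_ofReal_mul, Complex.conj_re]
  have hs : √(1 + ‖b t‖ ^ 2) ^ 2 = 1 + ‖b t‖ ^ 2 := sq_sqrt hq.le
  have hs0 : 0 < √(1 + ‖b t‖ ^ 2) := by positivity
  have e : 2 * ((1 + ‖b t‖ ^ 2) * X.re) / (2 * √(1 + ‖b t‖ ^ 2)) = √(1 + ‖b t‖ ^ 2) * X.re := by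
    rw [div_eq_iff (by positivity)]; linear_combination (-2 * X.re) * hs
  rw [hre, hXa, e]
  conv_rhs => rw [← Complex.re_add_im X]
  simp only [amp]
  push_cast
  ring

theorem continuousOn_shift (h : IsFlow η σ α b) : ContinuousOn b (Icc 0 1) :=
  fun t ht => (h.hasDeriv_shift t ht).continuousWithinAt

/-- Left translations map flows to flows. -/
theorem mul (h : IsFlow η σ α b) (α₀ : ℝ) (b₀ : ℂ) :
    IsFlow η σ (fun t => mulTime α₀ b₀ (α t) (b t)) (fun t => mulShift α₀ b₀ (α t) (b t)) where
  nonneg := h.nonneg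
  cone := h.cone
  hasDeriv_time t ht := by
    have ha := h.hasDeriv_amp ht
    have hb := hasDerivWithinAt_conj (h.hasDeriv_shift t ht)
    have h0 := amp_ne_zero α₀ b₀
    have h1 := amp_ne_zero (α t) (b t)
    have hA := amp_ne_zero (mulTime α₀ b₀ (α t) (b t)) (mulShift α₀ b₀ (α t) (b t))
    have hz : HasDerivWithinAt (fun t => 1 + b₀ * conj (b t) / (amp α₀ b₀ * amp (α t) (b t))) _
        (Icc 0 1) t := ((hb.const_mul b₀).div (ha.const_mul (amp α₀ b₀))
          (mul_ne_zero h0 h1)).const_add 1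
    have hpos := re_one_add_pos (norm_mul_conj_div_lt_one α₀ b₀ (α t) (b t))
    have hlog := hasDerivWithinAt_im (hz.clog_real (Or.inl hpos))
    simp only [Complex.log_im] at hlog
    refine (((h.hasDeriv_time t ht).const_add α₀).add hlog).congr_deriv ?_
    rw [add_assoc, ← Complex.add_im]
    congr 2
    rw [amp_mul] at hA ⊢
    have e : 1 + b₀ * conj (b t) / (amp α₀ b₀ * amp (α t) (b t)) =
        (amp α₀ b₀ * amp (α t) (b t) + b₀ * conj (b t)) / (amp α₀ b₀ * amp (α t) (b t)) := by
      field_simp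
    rw [e, mulShift]
    simp only [map_sub, map_mul, Complex.conj_ofReal, Complex.conj_I]
    generalize hAd : amp α₀ b₀ * amp (α t) (b t) + b₀ * conj (b t) = A at hA ⊢
    field_simp
    rw [← hAd]
    ring
  hasDeriv_shift t ht := by
    have ha := hasDerivWithinAt_conj (h.hasDeriv_amp ht)
    refine (((h.hasDeriv_shift t ht).const_mul _).add (ha.const_mul b₀)).congr_deriv ?_
    rw [amp_mul, mulShift]
    simp only [map_add, map_mul, Complex.conj_ofReal, Complex.conj_I, Complex.conj_conj]
    ring

/-- Time reversal, composed with a reflection of the plane, maps flows to flows. -/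
theorem reverse (h : IsFlow η σ α b) :
    IsFlow η (-conj (shear η σ 1)) (fun t => -α (1 - t)) (fun t => conj (b (1 - t))) := by
  have hmaps : MapsTo (fun t : ℝ => 1 - t) (Icc 0 1) (Icc 0 1) := fun t ht =>
    ⟨by linarith [ht.2], by linarith [ht.1]⟩
  have hd : ∀ t : ℝ, HasDerivWithinAt (fun t : ℝ => 1 - t) (-1) (Icc 0 1) t := fun t => by
    simpa using ((hasDerivAt_id t).const_sub 1).hasDerivWithinAt
  have hsh : ∀ t, shear η (-conj (shear η σ 1)) t = -conj (shear η σ (1 - t)) := fun t => by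
    simp only [shear, map_mul, ← Complex.exp_conj, Complex.conj_ofReal, Complex.conj_I, neg_mul,
      mul_assoc, ← Complex.exp_add]
    congr 3
    push_cast; ring
  refine ⟨h.nonneg, by rw [norm_neg, Complex.norm_conj, norm_shear]; exact h.cone, ?_, ?_⟩
  · intro t ht
    refine ((h.hasDeriv_time _ (hmaps ht)).comp t (hd t) hmaps).neg.congr_deriv ?_
    beta_reduce
    rw [hsh, amp_neg_conj, map_neg, Complex.conj_conj, mul_neg (conj _), neg_div, Complex.neg_im]
    have : conj (b (1 - t)) * shear η σ (1 - t) / conj (amp (α (1 - t)) (b (1 - t))) =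
        conj (b (1 - t) * conj (shear η σ (1 - t)) / amp (α (1 - t)) (b (1 - t))) := by
      simp only [map_mul, map_div₀, Complex.conj_conj]
    rw [this, Complex.conj_im]
    ring
  · intro t ht
    have := (h.hasDeriv_shift _ (hmaps ht)).scomp t (hd t) hmaps
    refine (hasDerivWithinAt_conj this).congr_deriv ?_
    rw [hsh, amp_neg_conj]
    simp only [map_sub, map_mul, Complex.conj_ofReal, Complex.conj_I, neg_smul, one_smul, map_neg]
    ring

/-- The part of a flow between the parameters `s` and `u`, parametrised by `[0, 1]`. -/
theorem restrict (h : IsFlow η σ α b) {s u : ℝ} (hs : 0 ≤ s) (hsu : s ≤ u) (hu : u ≤ 1) :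
    IsFlow ((u - s) * η) ((u - s : ℝ) * shear η σ s) (fun t => α (s + (u - s) * t))
      (fun t => b (s + (u - s) * t)) := by
  have hus : 0 ≤ u - s := sub_nonneg.2 hsu
  have hmaps : MapsTo (fun t : ℝ => s + (u - s) * t) (Icc 0 1) (Icc 0 1) := fun t ht =>
    ⟨add_nonneg hs (mul_nonneg hus ht.1), by nlinarith [ht.2]⟩
  have hd : ∀ t : ℝ, HasDerivWithinAt (fun t : ℝ => s + (u - s) * t) (u - s) (Icc 0 1) t :=
    fun t => by
      simpa using (((hasDerivAt_id t).const_mul (u - s)).const_add s).hasDerivWithinAt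
  have hsh : ∀ t, shear ((u - s) * η) ((u - s : ℝ) * shear η σ s) t =
      (u - s : ℝ) * shear η σ (s + (u - s) * t) := fun t => by
    simp only [shear, mul_assoc, ← Complex.exp_add]
    congr 3
    push_cast; ring
  refine ⟨mul_nonneg hus h.nonneg, ?_, ?_, ?_⟩
  · rw [norm_mul, norm_shear, Complex.norm_real, mul_pow, mul_pow, norm_eq_abs, sq_abs]
    nlinarith [h.cone, sq_nonneg (u - s)]
  · intro t ht
    refine ((h.hasDeriv_time _ (hmaps ht)).comp t (hd t) hmaps).congr_deriv ?_
    beta_reduce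
    rw [hsh, map_mul, Complex.conj_ofReal, mul_left_comm, mul_div_assoc (((u - s : ℝ)) : ℂ),
      Complex.im_ofReal_mul]
    ring
  · intro t ht
    refine ((h.hasDeriv_shift _ (hmaps ht)).scomp t (hd t) hmaps).congr_deriv ?_
    rw [hsh, Complex.real_smul]
    push_cast
    ring

end IsFlow

theorem isFlow_const (α : ℝ) (b : ℂ) : IsFlow 0 0 (fun _ => α) (fun _ => b) where
  nonneg := le_rfl
  cone := by simp
  hasDeriv_time t _ := by simpa [shear] using hasDerivWithinAt_const t _ α
  hasDeriv_shift t _ := by simpa [shear] using hasDerivWithinAt_const t _ b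

/-! ### Bounds on time and radius along a flow -/

theorem eq_zero_of_hasDerivWithinAt_zero {E : Type*} [NormedAddCommGroup E] [NormedSpace ℝ E]
    {f : ℝ → E} (hf : ∀ t ∈ Icc (0 : ℝ) 1, HasDerivWithinAt f 0 (Icc 0 1) t) {t : ℝ}
    (ht : t ∈ Icc (0 : ℝ) 1) : f t = f 0 :=
  constant_of_derivWithin_zero (fun s hs => (hf s hs).differentiableWithinAt)
    (fun s hs => (hf s ⟨hs.1, hs.2.le⟩).derivWithin
      (uniqueDiffOn_Icc zero_lt_one s ⟨hs.1, hs.2.le⟩)) t ht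

/-- Here n = ‖b‖, z = n·n' and η + J = α'. The second bound is α' ≥ profile'(n)·|n'| cleared of
denominators; the hypothesis is the cone condition. -/
theorem time_deriv_bounds {n η J z : ℝ} (hn0 : 0 ≤ n) (hn1 : n ≤ 1) (hη : 0 ≤ η)
    (h : z ^ 2 + ((1 + n ^ 2) * J) ^ 2 ≤ 2 * ((1 + n ^ 2) * n ^ 2 * η ^ 2)) :
    0 ≤ η + J ∧ √(1 - n ^ 2) * |z| ≤ (η + J) * (n * (√2 * (1 + n ^ 2))) := by
  have hq : 0 < 1 + n ^ 2 := by positivity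
  have hn2 : n ^ 2 ≤ 1 := by nlinarith
  have h1 : (1 + n ^ 2) * J ^ 2 ≤ 2 * n ^ 2 * η ^ 2 := by
    have : (1 + n ^ 2) * ((1 + n ^ 2) * J ^ 2) ≤ (1 + n ^ 2) * (2 * n ^ 2 * η ^ 2) := by
      nlinarith [sq_nonneg z]
    exact le_of_mul_le_mul_left this hq
  have h2 : J ^ 2 ≤ η ^ 2 := by
    have : (1 + n ^ 2) * J ^ 2 ≤ (1 + n ^ 2) * η ^ 2 := by nlinarith [sq_nonneg η]
    exact le_of_mul_le_mul_left this hq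
  have h3 : 0 ≤ η + J := by linarith [(abs_le_of_sq_le_sq' h2 hη).1]
  refine ⟨h3, ?_⟩
  refine abs_le_of_sq_le_sq' ?_ (by positivity) |>.2
  rw [mul_pow, sq_sqrt (by linarith), sq_abs, mul_pow, mul_pow, mul_pow, sq_sqrt (by norm_num)]
  have h4 : z ^ 2 ≤ (1 + n ^ 2) * (2 * n ^ 2 * η ^ 2 - (1 + n ^ 2) * J ^ 2) := by nlinarith
  have h5 := mul_le_mul_of_nonneg_left h4 (by linarith : 0 ≤ 1 - n ^ 2)
  have h6 : (1 - n ^ 2) * (2 * n ^ 2 * η ^ 2 - (1 + n ^ 2) * J ^ 2) ≤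
      2 * (η + J) ^ 2 * n ^ 2 * (1 + n ^ 2) := by
    -- The two sides differ by exactly this square, which vanishes when J is as for a flow through
    -- the axis.
    nlinarith [sq_nonneg (2 * n ^ 2 * η + (1 + n ^ 2) * J)]
  nlinarith [mul_le_mul_of_nonneg_left h6 hq.le]

theorem time_deriv_pos {n η J z : ℝ} (hn1 : n < 1) (hn0 : 0 ≤ n) (hη : 0 < η)
    (h : z ^ 2 + ((1 + n ^ 2) * J) ^ 2 ≤ 2 * ((1 + n ^ 2) * n ^ 2 * η ^ 2)) : 0 < η + J := by
  have hq : 0 < 1 + n ^ 2 := by positivity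
  have hn2 : n ^ 2 < 1 := by nlinarith
  have h1 : (1 + n ^ 2) * J ^ 2 ≤ 2 * n ^ 2 * η ^ 2 := by
    have : (1 + n ^ 2) * ((1 + n ^ 2) * J ^ 2) ≤ (1 + n ^ 2) * (2 * n ^ 2 * η ^ 2) := by
      nlinarith [sq_nonneg z]
    exact le_of_mul_le_mul_left this hq
  have h2 : J ^ 2 < η ^ 2 := by
    have : (1 + n ^ 2) * J ^ 2 < (1 + n ^ 2) * η ^ 2 := by nlinarith [sq_pos_of_pos hη]
    exact lt_of_mul_lt_mul_left this hq.le
  linarith [(abs_lt_of_sq_lt_sq' h2 hη.le).1]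

/-- Here ρ is to be the smoothed radius √(n²+ε²), whose derivative is z/ρ. -/
theorem profile_deriv_mul_le {n ρ D z : ℝ} (hn0 : 0 ≤ n) (hρ : 0 < ρ) (hnρ : n ≤ ρ) (hD : 0 ≤ D)
    (hz0 : n = 0 → z = 0) (h : √(1 - n ^ 2) * |z| ≤ D * (n * (√2 * (1 + n ^ 2)))) :
    √(1 - ρ ^ 2) / (√2 * (1 + ρ ^ 2)) * (z / ρ) ≤ D := by
  have hs : 0 < √2 := by positivity
  rcases hn0.eq_or_lt with hn | hn
  · rw [hz0 hn.symm]; simpa using hD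
  rw [div_mul_div_comm, div_le_iff₀ (by positivity)]
  have h1 : √(1 - ρ ^ 2) ≤ √(1 - n ^ 2) := sqrt_le_sqrt (by nlinarith)
  calc √(1 - ρ ^ 2) * z ≤ √(1 - ρ ^ 2) * |z| :=
        mul_le_mul_of_nonneg_left (le_abs_self z) (sqrt_nonneg _)
    _ ≤ √(1 - n ^ 2) * |z| := mul_le_mul_of_nonneg_right h1 (abs_nonneg z)
    _ ≤ D * (n * (√2 * (1 + n ^ 2))) := h
    _ ≤ D * (√2 * (1 + ρ ^ 2) * ρ) := by
        refine mul_le_mul_of_nonneg_left ?_ hD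
        rw [mul_comm n]
        gcongr

namespace IsFlow

variable {η : ℝ} {σ : ℂ} {α : ℝ → ℝ} {b : ℝ → ℂ}

theorem norm_le (h : IsFlow η σ α b) : ‖σ‖ ≤ √2 * η := by
  refine abs_le_of_sq_le_sq' ?_ (mul_nonneg (sqrt_nonneg _) h.nonneg) |>.2
  rw [mul_pow, sq_sqrt (by norm_num)]; exact h.cone

theorem im_div_amp (s : ℂ) (α : ℝ) (b : ℂ) :
    (1 + ‖b‖ ^ 2) * (b * conj s / amp α b).im = -(conj b * amp α b * s).im := by
  have h : conj b * amp α b * s = conj (((1 + ‖b‖ ^ 2 : ℝ) : ℂ) * (b * conj s / amp α b)) := by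
    rw [← norm_amp_sq α b]
    have h0 := amp_ne_zero α b
    push_cast
    rw [← Complex.mul_conj']
    field_simp
    simp only [map_mul, Complex.conj_conj]
    ring
  rw [h, Complex.conj_im, Complex.im_ofReal_mul, neg_neg]

theorem planar_bound (h : IsFlow η σ α b) (t : ℝ) :
    (conj (b t) * amp (α t) (b t) * shear η σ t).re ^ 2 + ((1 + ‖b t‖ ^ 2) *
      (b t * conj (shear η σ t) / amp (α t) (b t)).im) ^ 2 ≤
    2 * ((1 + ‖b t‖ ^ 2) * ‖b t‖ ^ 2 * η ^ 2) := by
  rw [im_div_amp, neg_sq, sq, sq, ← Complex.normSq_apply, Complex.normSq_eq_norm_sq, norm_mul,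
    norm_mul, norm_shear, Complex.norm_conj, mul_pow, mul_pow, norm_amp_sq]
  have := mul_le_mul_of_nonneg_left h.cone
    (by positivity : 0 ≤ ‖b t‖ ^ 2 * (1 + ‖b t‖ ^ 2))
  linarith

/-- Conservation of angular momentum. -/
theorem angular_momentum (h : IsFlow η σ α b) {t : ℝ} (ht : t ∈ Icc (0 : ℝ) 1) :
    η * (1 + 2 * ‖b t‖ ^ 2) - (conj (b t) * amp (α t) (b t) * shear η σ t).im =
    η * (1 + 2 * ‖b 0‖ ^ 2) - (conj (b 0) * amp (α 0) (b 0) * shear η σ 0).im := by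
  refine eq_zero_of_hasDerivWithinAt_zero (f := fun t => η * (1 + 2 * ‖b t‖ ^ 2) -
    (conj (b t) * amp (α t) (b t) * shear η σ t).im) (fun t ht => ?_) ht
  have h1 := (((h.hasDeriv_norm_sq ht).const_mul 2).const_add 1).const_mul η
  have h2 := hasDerivWithinAt_im (((hasDerivWithinAt_conj (h.hasDeriv_shift t ht)).mul
    (h.hasDeriv_amp ht)).mul (hasDerivAt_shear η σ t).hasDerivWithinAt)
  refine (h1.sub h2).congr_deriv ?_
  simp only [Pi.mul_apply]
  set P := conj (b t) * amp (α t) (b t) * shear η σ t with hP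
  have e : (conj (amp (α t) (b t) * shear η σ t - η * Complex.I * b t) * amp (α t) (b t) +
      conj (b t) * (η * Complex.I * amp (α t) (b t) + b t * conj (shear η σ t))) * shear η σ t +
      conj (b t) * amp (α t) (b t) * (2 * η * Complex.I * shear η σ t) =
      ((‖amp (α t) (b t)‖ ^ 2 * ‖shear η σ t‖ ^ 2 + ‖b t‖ ^ 2 * ‖shear η σ t‖ ^ 2 : ℝ) : ℂ) +
      ((4 * η : ℝ) : ℂ) * (P * Complex.I) := by
    push_cast
    rw [← Complex.mul_conj', ← Complex.mul_conj', ← Complex.mul_conj', hP]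
    simp only [map_sub, map_mul, Complex.conj_ofReal, Complex.conj_I]
    ring
  rw [e, Complex.add_im, Complex.ofReal_im, Complex.im_ofReal_mul, Complex.mul_I_im]
  ring

/-- Starting on the axis fixes the angular momentum, so 2ηn² = Im(b̄as) ≤ n√(1+n²)·√2η, which forces
n ≤ 1. -/
theorem norm_shift_le_one (h : IsFlow η σ α b) (h0 : b 0 = 0) {t : ℝ} (ht : t ∈ Icc (0 : ℝ) 1) :
    ‖b t‖ ≤ 1 := by
  rcases h.nonneg.eq_or_lt with hη | hη
  · have hσ : σ = 0 := by
      have := h.norm_le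
      rw [← hη, mul_zero] at this
      exact norm_le_zero_iff.1 this
    have := eq_zero_of_hasDerivWithinAt_zero (f := b) (fun t ht =>
      (h.hasDeriv_shift t ht).congr_deriv (by simp [shear, hσ, ← hη])) ht
    rw [this, h0]; simp
  · have h1 := h.angular_momentum ht
    simp only [h0, norm_zero, map_zero, zero_mul, Complex.zero_im] at h1
    have h2 : 2 * η * ‖b t‖ ^ 2 ≤ ‖b t‖ * √(1 + ‖b t‖ ^ 2) * (√2 * η) := by
      calc 2 * η * ‖b t‖ ^ 2 = (conj (b t) * amp (α t) (b t) * shear η σ t).im := by linarith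
        _ ≤ ‖conj (b t) * amp (α t) (b t) * shear η σ t‖ :=
          (le_abs_self _).trans (Complex.abs_im_le_norm _)
        _ ≤ _ := by
          rw [norm_mul, norm_mul, Complex.norm_conj, norm_amp, norm_shear]
          exact mul_le_mul_of_nonneg_left h.norm_le (by positivity)
    by_contra! hlt
    have h3 : √2 * √(1 + ‖b t‖ ^ 2) < 2 * ‖b t‖ := by
      rw [← sqrt_mul (by norm_num), sqrt_lt' (by positivity)]
      nlinarith
    nlinarith [mul_pos hη (by linarith : 0 < ‖b t‖)]

theorem continuousOn_time (h : IsFlow η σ α b) : ContinuousOn α (Icc 0 1) :=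
  fun t ht => (h.hasDeriv_time t ht).continuousWithinAt

/-- Within the horizon the time exceeds the profile by more and more. -/
theorem profile_sub_le (h : IsFlow η σ α b) (hb : ∀ t ∈ Icc (0 : ℝ) 1, ‖b t‖ ≤ 1) :
    profile ‖b 1‖ - profile ‖b 0‖ ≤ α 1 - α 0 := by
  -- The norm ‖b‖ need not be differentiable where b = 0; it is smoothed by ε, and then ε → 0.
  have key : ∀ ε > 0, 0 ≤ (α 1 - profile √(‖b 1‖ ^ 2 + ε ^ 2)) -
      (α 0 - profile √(‖b 0‖ ^ 2 + ε ^ 2)) := by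
    intro ε hε
    have hd : ∀ t ∈ Icc (0 : ℝ) 1, HasDerivWithinAt
        (fun t => α t - profile √(‖b t‖ ^ 2 + ε ^ 2)) _ (Icc 0 1) t := fun t ht =>
      (h.hasDeriv_time t ht).sub ((hasDerivAt_profile _).comp_hasDerivWithinAt t
        (((h.hasDeriv_norm_sq ht).add_const (ε ^ 2)).sqrt (by positivity)))
    have := monotoneOn_of_hasDerivWithinAt_nonneg (convex_Icc (0 : ℝ) 1)
      (fun t ht => (hd t ht).continuousWithinAt)
      (fun t ht => (hd t (interior_subset ht)).mono interior_subset) (fun t ht => ?_)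
      (left_mem_Icc.2 zero_le_one) (right_mem_Icc.2 zero_le_one) zero_le_one
    · exact sub_nonneg.2 this
    · obtain ⟨h1, h2⟩ := time_deriv_bounds (norm_nonneg _) (hb t (interior_subset ht)) h.nonneg
        (h.planar_bound t)
      have h3 := profile_deriv_mul_le (norm_nonneg _) (ρ := √(‖b t‖ ^ 2 + ε ^ 2)) (by positivity)
        (le_sqrt_of_sq_le (by nlinarith)) h1 (fun h0 => by simp [norm_eq_zero.1 h0]) h2
      rw [mul_div_mul_left _ _ two_ne_zero]
      exact sub_nonneg.2 h3
  have hc : Continuous fun ε : ℝ => (α 1 - profile √(‖b 1‖ ^ 2 + ε ^ 2)) -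
      (α 0 - profile √(‖b 0‖ ^ 2 + ε ^ 2)) := by
    have := continuous_profile
    fun_prop
  have := ge_of_tendsto ((hc.tendsto 0).mono_left nhdsWithin_le_nhds)
    (eventually_mem_nhdsWithin.mono key : ∀ᶠ ε in 𝓝[>] (0 : ℝ), _)
  simp only [ne_eq, OfNat.ofNat_ne_zero, not_false_eq_true, zero_pow, add_zero,
    sqrt_sq (norm_nonneg _)] at this
  linarith

theorem time_le (h : IsFlow η σ α b) (hb : ∀ t ∈ Icc (0 : ℝ) 1, ‖b t‖ ≤ 1) : α 0 ≤ α 1 :=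
  monotoneOn_of_hasDerivWithinAt_nonneg (convex_Icc (0 : ℝ) 1) h.continuousOn_time
    (fun t ht => (h.hasDeriv_time t (interior_subset ht)).mono interior_subset)
    (fun t ht => (time_deriv_bounds (norm_nonneg _) (hb t (interior_subset ht)) h.nonneg
      (h.planar_bound t)).1)
    (left_mem_Icc.2 zero_le_one) (right_mem_Icc.2 zero_le_one) zero_le_one

theorem time_lt (h : IsFlow η σ α b) (hη : 0 < η) (hb : ∀ t ∈ Icc (0 : ℝ) 1, ‖b t‖ < 1) :
    α 0 < α 1 :=
  strictMonoOn_of_hasDerivWithinAt_pos (convex_Icc (0 : ℝ) 1) h.continuousOn_time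
    (fun t ht => (h.hasDeriv_time t (interior_subset ht)).mono interior_subset)
    (fun t ht => time_deriv_pos (hb t (interior_subset ht)) (norm_nonneg _) hη
      (h.planar_bound t))
    (left_mem_Icc.2 zero_le_one) (right_mem_Icc.2 zero_le_one) zero_lt_one

/-- The endpoint of a flow, relative to its starting point. -/
theorem exists_step (h : IsFlow η σ α b) : ∃ (A : ℝ) (B : ℂ), ‖B‖ ≤ 1 ∧ profile ‖B‖ ≤ A ∧
    α 1 = mulTime (α 0) (b 0) A B ∧ b 1 = mulShift (α 0) (b 0) A B := by
  have hrel := h.mul (-α 0) (-b 0)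
  have hle := fun t => hrel.norm_shift_le_one (t := t) (mulShift_neg_neg_self (α 0) (b 0))
  refine ⟨_, _, hle 1 (right_mem_Icc.2 zero_le_one), ?_,
    (mulTime_mul_neg_neg (α 0) (b 0) (α 1) (b 1)).symm,
    (mulShift_mul_neg_neg (α 0) (b 0) (α 1) (b 1)).symm⟩
  have := hrel.profile_sub_le hle
  simpa only [mulShift_neg_neg_self, mulTime_neg_neg_self, norm_zero, profile_zero, sub_zero]
    using this

end IsFlow

/-! ### The least time and its numerical value -/

/-- The earliest time, in the unit of the lifted argument, that three segments reach by way of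
the horizon. -/
def leastTime : ℝ := 3 * profile 1 - arctan (3 * √(3 / 5))

theorem leastTime_le_of_two_steps {η₁ η₂ : ℝ} {σ₁ σ₂ : ℂ} {α₁ α₂ : ℝ → ℝ} {b₁ b₂ : ℝ → ℂ}
    (h₁ : IsFlow η₁ σ₁ α₁ b₁) (h₂ : IsFlow η₂ σ₂ α₂ b₂) (hα : α₁ 1 = α₂ 0) (hb : b₁ 1 = b₂ 0)
    (hstart : profile 1 ≤ α₁ 0) (hstart' : ‖b₁ 0‖ ≤ 1) : leastTime ≤ α₂ 1 := by
  obtain ⟨A, B, hB, hA, e1, e2⟩ := h₁.exists_step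
  obtain ⟨A', B', hB', hA', e1', -⟩ := h₂.exists_step
  rw [← hα, ← hb, mulTime] at e1'
  have ea := amp_ne_zero A B
  have eca : conj (amp A B) ≠ 0 := (map_ne_zero _).2 ea
  have ea' := amp_ne_zero A' B'
  have e0 := amp_ne_zero (α₁ 0) (b₁ 0)
  have hX : ‖b₁ 0 / amp (α₁ 0) (b₁ 0)‖ ≤ 1 / √2 := by
    rw [norm_div_amp]; exact div_sqrt_le (norm_nonneg _) hstart'
  -- With a = `amp A B`, X + δ̄ equals b₁(1)/(a₀ā), whereas the product rule needs b₁(1)/(a₀a); the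
  -- phase ā/a in Y makes up the difference.
  have hgain := two_step_gain (X := b₁ 0 / amp (α₁ 0) (b₁ 0)) (δ := conj B / amp A B)
    (Y := conj B' / amp A' B' * (conj (amp A B) / amp A B)) hX (norm_nonneg B) hB (norm_nonneg B')
    hB' (by rw [norm_div, Complex.norm_conj, norm_amp])
    (by rw [norm_mul, norm_div, norm_div, Complex.norm_conj, Complex.norm_conj,
          div_self (norm_amp_pos _ _).ne', mul_one, norm_amp])
  have k1 : b₁ 0 / amp (α₁ 0) (b₁ 0) * (conj B / amp A B) =
      b₁ 0 * conj B / (amp (α₁ 0) (b₁ 0) * amp A B) := by rw [div_mul_div_comm]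
  have hb1 : amp (α₁ 1) (b₁ 1) = amp (α₁ 0) (b₁ 0) * amp A B + b₁ 0 * conj B := by
    rw [e1, e2, amp_mul]
  have hne := amp_ne_zero (α₁ 1) (b₁ 1)
  have k2 : conj B' / amp A' B' * (conj (amp A B) / amp A B) * (b₁ 0 / amp (α₁ 0) (b₁ 0) +
      conj (conj B / amp A B)) / (1 + b₁ 0 * conj B / (amp (α₁ 0) (b₁ 0) * amp A B)) =
      b₁ 1 * conj B' / (amp (α₁ 1) (b₁ 1) * amp A' B') := by
    have : 1 + b₁ 0 * conj B / (amp (α₁ 0) (b₁ 0) * amp A B) =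
        amp (α₁ 1) (b₁ 1) / (amp (α₁ 0) (b₁ 0) * amp A B) := by
      rw [hb1]; field_simp
    rw [this]
    generalize amp (α₁ 1) (b₁ 1) = A₁ at hne
    rw [e2, mulShift, map_div₀, Complex.conj_conj]
    field_simp
    ring
  rw [k1, k2] at hgain
  rw [mulTime] at e1
  rw [leastTime]
  linarith

theorem arctan_sqrt_two_sub_one : arctan (√2 - 1) = π / 8 := by
  have h2 : √2 ^ 2 = 2 := sq_sqrt (by norm_num)
  have hs : 1 < √2 := lt_sqrt_of_sq_lt (by norm_num)
  have hs2 : √2 < 2 := by nlinarith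
  have h := two_mul_arctan (x := √2 - 1) (by linarith) (by linarith)
  have e : 2 * (√2 - 1) / (1 - (√2 - 1) ^ 2) = 1 := by
    rw [div_eq_one_iff_eq (by nlinarith)]; linear_combination h2
  rw [e, arctan_one] at h
  linarith

theorem tauMin_eq : tauMin = √2 * leastTime := by
  have h2 : √2 ^ 2 = 2 := sq_sqrt (by norm_num)
  rw [tauMin, leastTime, profile_one]
  field_simp

theorem arctan_bounds {x : ℝ} (hx : 0 ≤ x) : x / √(1 + x ^ 2) ≤ arctan x ∧ arctan x ≤ x := by
  have h0 : 0 ≤ arctan x := arctan_nonneg.2 hx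
  refine ⟨?_, ?_⟩
  · rw [← sin_arctan]; exact sin_le h0
  · simpa using le_tan h0 (arctan_lt_pi_div_two x)

theorem tauMin_approx : |tauMin - 0.3052| < 0.00005 := by
  have h2 : √2 ^ 2 = 2 := sq_sqrt (by norm_num)
  have ha : 1.4142135 < √2 := lt_sqrt_of_sq_lt (by norm_num)
  have hb : √2 < 1.4142136 := (sqrt_lt' (by norm_num)).2 (by norm_num)
  set K := 3 * √(3 / 5) with hK
  have hK0 : 0 < K := by positivity
  have hK2 : K ^ 2 = 27 / 5 := by rw [hK, mul_pow, sq_sqrt (by norm_num)]; norm_num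
  set u := K⁻¹ with hu
  have hu0 : 0 < u := by positivity
  have hu2 : u ^ 2 = 5 / 27 := by rw [hu, inv_pow, hK2]; norm_num
  have hua : 0.4303314 < u := lt_of_pow_lt_pow_left₀ 2 hu0.le (by rw [hu2]; norm_num)
  have hub : u < 0.4303315 := lt_of_pow_lt_pow_left₀ 2 (by norm_num) (by rw [hu2]; norm_num)
  set t := √2 - 1 with ht
  -- Since tan(π/8) = √2 - 1 is close to u = 1/K, arctan u = π/8 + arctan ε with ε about 0.0137, so
  -- crude bounds on arctan ε suffice.
  set ε := (u - t) / (1 + u * t) with hε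
  have htpos : 0 < t := by linarith
  have hd : 0 < 1 + u * t := by positivity
  have hd1 : 1.17824 < 1 + u * t := by nlinarith
  have hd2 : 1 + u * t < 1.17826 := by nlinarith
  have hε0 : 0.013678 < ε := by rw [hε, lt_div_iff₀ hd]; nlinarith
  have hε1 : ε < 0.013680 := by rw [hε, div_lt_iff₀ hd]; nlinarith
  have hsum : arctan u = π / 8 + arctan ε := by
    rw [← arctan_sqrt_two_sub_one, ← ht, arctan_add (by nlinarith)]
    congr 1
    have : 1 - t * ε = (1 + t ^ 2) / (1 + u * t) := by rw [hε]; field_simp; ring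
    rw [this, hε, eq_div_iff (by positivity)]
    field_simp
    ring
  have hKu : arctan K = π / 2 - arctan u := by rw [hu, arctan_inv_of_pos hK0]; ring
  obtain ⟨hlo, hhi⟩ := arctan_bounds (by linarith : 0 ≤ ε)
  have hroot : √(1 + ε ^ 2) < 1.0001 := (sqrt_lt' (by norm_num)).2 (by nlinarith)
  have hlo' : 0.0136764 < arctan ε := by
    refine lt_of_lt_of_le ?_ hlo
    rw [lt_div_iff₀ (by positivity)]
    nlinarith
  have hp1 := pi_gt_d6
  have hp2 := pi_lt_d6
  have e : tauMin = (9 / 8 * √2 - 3 / 2) * π + √2 * arctan ε := by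
    rw [tauMin, ← hK, hKu, hsum]; ring
  rw [e, abs_lt]
  constructor <;> nlinarith

theorem tauMin_pos : 0 < tauMin := by
  have := abs_lt.1 tauMin_approx
  linarith [this.1]

theorem leastTime_pos : 0 < leastTime := by
  have h := tauMin_pos
  rw [tauMin_eq] at h
  exact pos_of_mul_pos_right h (sqrt_nonneg _)

/-! ### Three segments from the origin -/

namespace IsFlow

variable {η : ℝ} {σ : ℂ} {α : ℝ → ℝ} {b : ℝ → ℂ}

theorem time_le_of_le (h : IsFlow η σ α b) (hb : ∀ t ∈ Icc (0 : ℝ) 1, ‖b t‖ ≤ 1) {s u : ℝ}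
    (hs : 0 ≤ s) (hsu : s ≤ u) (hu : u ≤ 1) : α s ≤ α u := by
  have hus : 0 ≤ u - s := sub_nonneg.2 hsu
  simpa using (h.restrict hs hsu hu).time_le fun t ht =>
    hb _ ⟨add_nonneg hs (mul_nonneg hus ht.1), by nlinarith [ht.2]⟩

theorem profile_le_of_le (h : IsFlow η σ α b) (h0 : profile ‖b 0‖ ≤ α 0) {u : ℝ} (hu0 : 0 ≤ u)
    (hu : u ≤ 1) (hb : ∀ t ∈ Icc (0 : ℝ) u, ‖b t‖ ≤ 1) : profile ‖b u‖ ≤ α u := by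
  have := (h.restrict le_rfl hu0 hu).profile_sub_le fun t ht =>
    hb _ ⟨by nlinarith [ht.1], by nlinarith [ht.2]⟩
  simp only [sub_zero, mul_one, mul_zero, zero_add] at this
  linarith

/-- The parameter s is the first touch: up to it the flow is inside, so the profile bound persists.
-/
theorem reaches_horizon_or (h : IsFlow η σ α b) (h0 : ‖b 0‖ ≤ 1) (h0' : profile ‖b 0‖ ≤ α 0) :
    (∃ s ∈ Icc (0 : ℝ) 1, ‖b s‖ = 1 ∧ profile 1 ≤ α s) ∨
      (∀ t ∈ Icc (0 : ℝ) 1, ‖b t‖ < 1) ∧ profile ‖b 1‖ ≤ α 1 := by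
  by_cases hlt : ∀ t ∈ Icc (0 : ℝ) 1, ‖b t‖ < 1
  · exact Or.inr ⟨hlt, h.profile_le_of_le h0' zero_le_one le_rfl fun t ht => (hlt t ht).le⟩
  · left
    push Not at hlt
    have hcont := h.continuousOn_shift.norm
    have hclosed : IsCompact (Icc (0 : ℝ) 1 ∩ (fun t => ‖b t‖) ⁻¹' Ici 1) :=
      isCompact_Icc.of_isClosed_subset
        (hcont.preimage_isClosed_of_isClosed isClosed_Icc isClosed_Ici)
        inter_subset_left
    obtain ⟨s, ⟨hs, hs1⟩, hmin⟩ := hclosed.exists_isLeast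
      (let ⟨t, ht, ht1⟩ := hlt; ⟨t, ht, ht1⟩)
    obtain ⟨c, hc, hc1⟩ := intermediate_value_Icc hs.1
      (hcont.mono (Icc_subset_Icc_right hs.2)) ⟨h0, hs1⟩
    have hcs : c = s := le_antisymm hc.2
      (hmin ⟨⟨hc.1, hc.2.trans hs.2⟩, (hc1.ge : (1 : ℝ) ≤ ‖b c‖)⟩)
    rw [hcs] at hc1
    refine ⟨s, hs, hc1, ?_⟩
    have := h.profile_le_of_le h0' hs.1 hs.2 fun t ht => by
      rcases ht.2.eq_or_lt with rfl | hts
      · exact hc1.le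
      · by_contra! hgt
        exact absurd (hmin ⟨⟨ht.1, ht.2.trans hs.2⟩, hgt.le⟩) (not_le.2 hts)
    rwa [show ‖b s‖ = 1 from hc1] at this

end IsFlow

section ThreeSteps

variable {η₁ η₂ η₃ : ℝ} {σ₁ σ₂ σ₃ : ℂ} {α₁ α₂ α₃ : ℝ → ℝ} {b₁ b₂ b₃ : ℝ → ℂ}

/-- Three segments from the origin either stay within the horizon or take the least time. -/
theorem leastTime_le_or_inside (h₁ : IsFlow η₁ σ₁ α₁ b₁) (h₂ : IsFlow η₂ σ₂ α₂ b₂)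
    (h₃ : IsFlow η₃ σ₃ α₃ b₃) (hα0 : α₁ 0 = 0) (hb0 : b₁ 0 = 0) (hα12 : α₁ 1 = α₂ 0)
    (hb12 : b₁ 1 = b₂ 0) (hα23 : α₂ 1 = α₃ 0) (hb23 : b₂ 1 = b₃ 0) :
    leastTime ≤ α₃ 1 ∨ (∀ t ∈ Icc (0 : ℝ) 1, ‖b₁ t‖ < 1) ∧ (∀ t ∈ Icc (0 : ℝ) 1, ‖b₂ t‖ < 1) ∧
      ∀ t ∈ Icc (0 : ℝ) 1, ‖b₃ t‖ < 1 := by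
  have hmem : (1 : ℝ) ∈ Icc (0 : ℝ) 1 := right_mem_Icc.2 zero_le_one
  have hle₁ := fun t => h₁.norm_shift_le_one hb0 (t := t)
  rcases h₁.reaches_horizon_or (by simp [hb0]) (by simp [hb0, hα0]) with
    ⟨s, hs, -, hsα⟩ | ⟨hin₁, hp₁⟩
  · exact Or.inl (leastTime_le_of_two_steps h₂ h₃ hα23 hb23
      (hα12 ▸ hsα.trans (h₁.time_le_of_le hle₁ hs.1 hs.2 le_rfl)) (hb12 ▸ hle₁ 1 hmem))
  rw [hb12, hα12] at hp₁
  rcases h₂.reaches_horizon_or (hb12 ▸ hle₁ 1 hmem) hp₁ with ⟨s, hs, hsb, hsα⟩ | ⟨hin₂, hp₂⟩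
  -- The remainder of the second segment and the third are the two steps.
  · refine Or.inl (leastTime_le_of_two_steps (h₂.restrict hs.1 hs.2 le_rfl) h₃ ?_ ?_ ?_ ?_)
    · simpa using hα23
    · simpa using hb23
    · simpa using hsα
    · simpa using hsb.le
  rw [hb23, hα23] at hp₂
  rcases h₃.reaches_horizon_or (hb23 ▸ (hin₂ 1 hmem).le) hp₂ with ⟨s, hs, hsb, hsα⟩ | ⟨hin₃, -⟩
  -- Only the remainder of the third segment is left; a constant flow serves as the other step.
  · refine Or.inl (leastTime_le_of_two_steps (α₂ := fun _ => α₃ 1) (b₂ := fun _ => b₃ 1)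
      (h₃.restrict hs.1 hs.2 le_rfl)
      (isFlow_const (α₃ 1) (b₃ 1)) ?_ ?_ ?_ ?_)
    · simp
    · simp
    · simpa using hsα
    · simpa using hsb.le
  · exact Or.inr ⟨hin₁, hin₂, hin₃⟩

theorem time_pos_of_three_steps (h₁ : IsFlow η₁ σ₁ α₁ b₁) (h₂ : IsFlow η₂ σ₂ α₂ b₂)
    (h₃ : IsFlow η₃ σ₃ α₃ b₃) (hα0 : α₁ 0 = 0) (hb0 : b₁ 0 = 0) (hα12 : α₁ 1 = α₂ 0)
    (hb12 : b₁ 1 = b₂ 0) (hα23 : α₂ 1 = α₃ 0) (hb23 : b₂ 1 = b₃ 0) (hη : 0 < η₁) :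
    0 < α₃ 1 := by
  rcases leastTime_le_or_inside h₁ h₂ h₃ hα0 hb0 hα12 hb12 hα23 hb23 with h | ⟨i₁, i₂, i₃⟩
  · exact leastTime_pos.trans_le h
  · have e₁ := h₁.time_lt hη i₁
    have e₂ := h₂.time_le fun t ht => (i₂ t ht).le
    have e₃ := h₃.time_le fun t ht => (i₃ t ht).le
    linarith

end ThreeSteps

/-! ### Closed chains of flows -/

/-- `Joins η P Q` says that a flow of speed `η` leads from `P` to `Q`. -/
def Joins (η : ℝ) (P Q : ℝ × ℂ) : Prop :=
  ∃ σ α b, IsFlow η σ α b ∧ (α 0, b 0) = P ∧ (α 1, b 1) = Q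

theorem Joins.refl (P : ℝ × ℂ) : Joins 0 P P := ⟨0, _, _, isFlow_const P.1 P.2, rfl, rfl⟩

theorem Joins.mul {η : ℝ} {P Q : ℝ × ℂ} (h : Joins η P Q) (α : ℝ) (b : ℂ) :
    Joins η (mulTime α b P.1 P.2, mulShift α b P.1 P.2)
      (mulTime α b Q.1 Q.2, mulShift α b Q.1 Q.2) := by
  obtain ⟨σ, α', b', h, rfl, rfl⟩ := h
  exact ⟨σ, _, _, h.mul α b, rfl, rfl⟩

theorem Joins.reverse {η : ℝ} {P Q : ℝ × ℂ} (h : Joins η P Q) :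
    Joins η (-Q.1, conj Q.2) (-P.1, conj P.2) := by
  obtain ⟨σ, α, b, h, rfl, rfl⟩ := h
  exact ⟨_, _, _, h.reverse, by simp, by simp⟩

theorem Joins.time_pos {η₁ η₂ η₃ : ℝ} {P Q R : ℝ × ℂ} (h₁ : Joins η₁ (0, 0) P)
    (h₂ : Joins η₂ P Q) (h₃ : Joins η₃ Q R) (hη : 0 < η₁) : 0 < R.1 := by
  obtain ⟨σ₁, α₁, b₁, h₁, e₁, rfl⟩ := h₁
  obtain ⟨σ₂, α₂, b₂, h₂, e₂, rfl⟩ := h₂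
  obtain ⟨σ₃, α₃, b₃, h₃, e₃, rfl⟩ := h₃
  simp only [Prod.mk.injEq] at e₁ e₂ e₃
  exact time_pos_of_three_steps h₁ h₂ h₃ e₁.1 e₁.2 e₂.1.symm e₂.2.symm e₃.1.symm e₃.2.symm hη

/-- No closed chain of flows has at most six steps. -/
theorem not_closed_of_le_six {n : ℕ} (hn0 : 0 < n) (hn : n ≤ 6) (P : ℕ → ℝ × ℂ)
    (hP : ∀ i < n, ∃ η > 0, Joins η (P i) (P (i + 1))) : P n ≠ P 0 := by
  intro hclosed
  wlog h0 : P 0 = (0, 0) generalizing P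
  · refine this (fun i => (mulTime (-(P 0).1) (-(P 0).2) (P i).1 (P i).2,
      mulShift (-(P 0).1) (-(P 0).2) (P i).1 (P i).2)) (fun i hi => ?_) (by simp [hclosed])
      (by simp [mulTime_neg_neg_self, mulShift_neg_neg_self])
    obtain ⟨η, hη, h⟩ := hP i hi
    exact ⟨η, hη, h.mul _ _⟩
  -- Constant flows pad short chains, so indices capped by `min` or `max` still give three steps on
  -- each side; only the first step needs η > 0.
  have hweak : ∀ i j, i ≤ j → j ≤ i + 1 → j ≤ n → ∃ η, Joins η (P i) (P j) := by
    intro i j hij hji hj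
    rcases hij.eq_or_lt with rfl | hlt
    · exact ⟨0, Joins.refl _⟩
    · obtain rfl : j = i + 1 := by omega
      obtain ⟨η, -, h⟩ := hP i (by omega)
      exact ⟨η, h⟩
  obtain ⟨η, hη, hfirst⟩ := hP 0 hn0
  rw [h0] at hfirst
  obtain ⟨_, h12⟩ := hweak 1 (min 2 n) (by omega) (by omega) (by omega)
  obtain ⟨_, h23⟩ := hweak (min 2 n) (min 3 n) (by omega) (by omega) (by omega)
  have hpos := Joins.time_pos hfirst h12 h23 hη
  rcases le_or_gt n 3 with h3 | h3
  · rw [min_eq_right h3, hclosed, h0] at hpos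
    exact lt_irrefl _ hpos
  · rw [min_eq_left h3.le] at hpos
    obtain ⟨η', hη', hlast⟩ := hP (n - 1) (by omega)
    rw [show n - 1 + 1 = n by omega, hclosed, h0] at hlast
    obtain ⟨_, k12⟩ := hweak (max (n - 2) 3) (n - 1) (by omega) (by omega) (by omega)
    obtain ⟨_, k23⟩ := hweak 3 (max (n - 2) 3) (by omega) (by omega) (by omega)
    -- Reversal negates time and fixes the origin, so the last half, run backwards, gives the cut
    -- point negative time.
    have hlast' := hlast.reverse
    simp only [neg_zero, map_zero] at hlast'
    have hneg := Joins.time_pos hlast' k12.reverse k23.reverse hη'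
    simp only at hneg
    linarith

/-! ### The geodesic equation of the metric -/

/-- The directional derivative of the metric. -/
def metricDir (p v : Event) : Matrix (Fin 4) (Fin 4) ℝ :=
  let D := 1 + p 1 ^ 2 + p 2 ^ 2
  let D' := 2 * p 1 * v 1 + 2 * p 2 * v 2
  let xy' := v 1 * p 2 + p 1 * v 2 - ((v 1 * p 2 + p 1 * v 2) * D - p 1 * p 2 * D') / D ^ 2
  !![0, √2 * v 2, -(√2 * v 1), 0;
     √2 * v 2, -(2 * p 2 * v 2) - (2 * p 1 * v 1 * D - p 1 ^ 2 * D') / D ^ 2, xy', 0;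
     -(√2 * v 1), xy', -(2 * p 1 * v 1) - (2 * p 2 * v 2 * D - p 2 ^ 2 * D') / D ^ 2, 0;
     0, 0, 0, 0]

theorem differentiable_metric (i j : Fin 4) : Differentiable ℝ fun q : Event => metric q i j := by
  have hne : ∀ q : Event, 1 + q 1 ^ 2 + q 2 ^ 2 ≠ 0 := fun q => by positivity
  fin_cases i <;> fin_cases j <;> simp [metric] <;> fun_prop (disch := exact hne)

theorem hasDerivAt_metric_line (p v : Event) (i j : Fin 4) :
    HasDerivAt (fun t : ℝ => metric (p + t • v) i j) (metricDir p v i j) 0 := by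
  have hl : ∀ k, HasDerivAt (fun t : ℝ => (p + t • v) k) (v k) 0 := fun k => by
    simpa using ((hasDerivAt_id (0 : ℝ)).mul_const (v k)).const_add (p k)
  have hX := hl 1
  have hY := hl 2
  have hne : 1 + (p + (0 : ℝ) • v) 1 ^ 2 + (p + (0 : ℝ) • v) 2 ^ 2 ≠ 0 := by positivity
  have hX2 := hX.pow 2
  have hY2 := hY.pow 2
  have hD := (hX2.const_add 1).add hY2
  have hXY := hX.mul hY
  have e01 := hY.const_mul √2
  have e02 := (hX.const_mul √2).neg
  have e11 := (hY2.const_sub 1).sub (hX2.div hD hne)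
  have e12 := hXY.sub (hXY.div hD hne)
  have e22 := (hX2.const_sub 1).sub (hY2.div hD hne)
  fin_cases i <;> fin_cases j
  exacts [hasDerivAt_const _ _, e01, e02, hasDerivAt_const _ _, e01,
    e11.congr_deriv (by simp [metricDir]), e12.congr_deriv (by simp [metricDir]),
    hasDerivAt_const _ _, e02, e12.congr_deriv (by simp [metricDir]),
    e22.congr_deriv (by simp [metricDir]), hasDerivAt_const _ _, hasDerivAt_const _ _,
    hasDerivAt_const _ _, hasDerivAt_const _ _, hasDerivAt_const _ _]

theorem fderiv_metric (p v : Event) (i j : Fin 4) :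
    fderiv ℝ (fun q : Event => metric q i j) p v = metricDir p v i j := by
  have hl : HasDerivAt (fun t : ℝ => p + t • v) v 0 := by
    simpa using ((hasDerivAt_id (0 : ℝ)).smul_const v).const_add p
  have hF : HasFDerivAt (fun q : Event => metric q i j)
      (fderiv ℝ (fun q : Event => metric q i j) p) (p + (0 : ℝ) • v) := by
    simpa using (differentiable_metric i j p).hasFDerivAt
  have h : HasDerivAt (fun t : ℝ => metric (p + t • v) i j)
      (fderiv ℝ (fun q : Event => metric q i j) p v) 0 :=
    HasFDerivAt.comp_hasDerivAt (f := fun t : ℝ => p + t • v) 0 hF hl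
  exact h.unique (hasDerivAt_metric_line p v i j)

theorem christoffel_eq (p : Event) (k i j : Fin 4) :
    christoffel p k i j = (metricDir p (Pi.single i 1) k j + metricDir p (Pi.single j 1) k i
      - metricDir p (Pi.single k 1) i j) / 2 := by
  simp only [christoffel, metricDeriv, fderiv_metric]

/-- The left-hand side of the geodesic equation. -/
def geodesicForm (p v a : Event) (k : Fin 4) : ℝ :=
  ∑ j, metric p k j * a j + ∑ i, ∑ j, christoffel p k i j * v i * v j

/-- The derivative of the energy, up to a factor. -/
theorem geodesicForm_zero (p v a : Event) :
    geodesicForm p v a 0 = -a 0 + √2 * p 2 * a 1 - √2 * p 1 * a 2 := by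
  simp [geodesicForm, christoffel_eq, metricDir, metric, Fin.sum_univ_four]
  ring

theorem geodesicForm_three (p v a : Event) : geodesicForm p v a 3 = a 3 := by
  simp [geodesicForm, christoffel_eq, metricDir, metric, Fin.sum_univ_four]

/-- The first component of the defect of the planar equation of motion. -/
def planarX (p v a : Event) : ℝ :=
  let D := 1 + p 1 ^ 2 + p 2 ^ 2
  let z := p 1 * v 1 + p 2 * v 2
  D * a 1 - p 1 * (v 1 ^ 2 + v 2 ^ 2 + p 1 * a 1 + p 2 * a 2) + p 1 * z ^ 2 / D +
    2 * (√2 * v 0 + (p 1 * v 2 - p 2 * v 1)) * (D * v 2 - p 2 * z)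

/-- The second component of the defect of the planar equation of motion. -/
def planarY (p v a : Event) : ℝ :=
  let D := 1 + p 1 ^ 2 + p 2 ^ 2
  let z := p 1 * v 1 + p 2 * v 2
  D * a 2 - p 2 * (v 1 ^ 2 + v 2 ^ 2 + p 1 * a 1 + p 2 * a 2) + p 2 * z ^ 2 / D -
    2 * (√2 * v 0 + (p 1 * v 2 - p 2 * v 1)) * (D * v 1 - p 1 * z)

/-- Multiples of the time equation remove a⁰. The 2×2 matrix of coefficients here and in
`planarY_eq` has determinant 1+x²+y², so the combination can be undone. -/
theorem planarX_eq (p v a : Event) : planarX p v a =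
    (1 + p 1 ^ 2) * (geodesicForm p v a 1 + √2 * p 2 * geodesicForm p v a 0) +
      p 1 * p 2 * (geodesicForm p v a 2 - √2 * p 1 * geodesicForm p v a 0) := by
  have h2 : √2 ^ 2 = 2 := sq_sqrt (by norm_num)
  rw [geodesicForm_zero]
  simp [planarX, geodesicForm, christoffel_eq, metricDir, metric, Fin.sum_univ_four]
  field_simp
  ring_nf
  simp only [h2]
  ring

theorem planarY_eq (p v a : Event) : planarY p v a =
    p 1 * p 2 * (geodesicForm p v a 1 + √2 * p 2 * geodesicForm p v a 0) +
      (1 + p 2 ^ 2) * (geodesicForm p v a 2 - √2 * p 1 * geodesicForm p v a 0) := by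
  have h2 : √2 ^ 2 = 2 := sq_sqrt (by norm_num)
  rw [geodesicForm_zero]
  simp [planarY, geodesicForm, christoffel_eq, metricDir, metric, Fin.sum_univ_four]
  field_simp
  ring_nf
  simp only [h2]
  ring

/-- The geodesic equation in terms of the conservation laws and the planar motion. -/
theorem geodesicForm_eq_zero_iff (p v a : Event) : (∀ k, geodesicForm p v a k = 0) ↔
    -a 0 + √2 * p 2 * a 1 - √2 * p 1 * a 2 = 0 ∧ planarX p v a = 0 ∧ planarY p v a = 0 ∧
      a 3 = 0 := by
  constructor
  · intro h
    refine ⟨?_, ?_, ?_, ?_⟩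
    · rw [← geodesicForm_zero p v a, h]
    · simp [planarX_eq, h]
    · simp [planarY_eq, h]
    · rw [← geodesicForm_three p v a, h]
  · rintro ⟨h0, hx, hy, h3⟩
    rw [← geodesicForm_zero p v a] at h0
    rw [← geodesicForm_three p v a] at h3
    rw [planarX_eq, h0] at hx
    rw [planarY_eq, h0] at hy
    have hD : 1 + p 1 ^ 2 + p 2 ^ 2 ≠ 0 := by positivity
    have h1 : geodesicForm p v a 1 = 0 := by
      refine (mul_eq_zero.1 ?_).resolve_left hD
      linear_combination (1 + p 2 ^ 2) * hx - p 1 * p 2 * hy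
    have h2 : geodesicForm p v a 2 = 0 := by
      refine (mul_eq_zero.1 ?_).resolve_left hD
      linear_combination (1 + p 1 ^ 2) * hy - p 1 * p 2 * hx
    intro k
    fin_cases k
    exacts [h0, h1, h2, h3]

/-- The planar velocity in a frame of the hyperbolic plane. -/
def planarVel (p v : Event) : ℂ :=
  let D := 1 + p 1 ^ 2 + p 2 ^ 2
  let z := p 1 * v 1 + p 2 * v 2
  (((D * v 1 - p 1 * z : ℝ) : ℂ) + ((D * v 2 - p 2 * z : ℝ) : ℂ) * Complex.I) / (√D : ℝ)

/-- On a geodesic the defects vanish, and the planar velocity merely rotates. -/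
theorem hasDerivWithinAt_planarVel {γ v : ℝ → Event} {a : Event} {s : Set ℝ} {t : ℝ}
    (hγ : HasDerivWithinAt γ (v t) s t) (hv : HasDerivWithinAt v a s t) :
    HasDerivWithinAt (fun t => planarVel (γ t) (v t))
      ((planarX (γ t) (v t) a + planarY (γ t) (v t) a * Complex.I) /
          (√(1 + γ t 1 ^ 2 + γ t 2 ^ 2) : ℝ) +
        2 * (√2 * v t 0 + (γ t 1 * v t 2 - γ t 2 * v t 1) : ℝ) * Complex.I *
          planarVel (γ t) (v t)) s t := by
  rw [hasDerivWithinAt_pi] at hγ hv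
  have hDpos : 0 < 1 + γ t 1 ^ 2 + γ t 2 ^ 2 := by positivity
  have hD := (((hγ 1).pow 2).const_add 1).add ((hγ 2).pow 2)
  have hz := ((hγ 1).mul (hv 1)).add ((hγ 2).mul (hv 2))
  have h1 := ((hD.mul (hv 1)).sub ((hγ 1).mul hz)).ofReal_comp
  have h2 := (((hD.mul (hv 2)).sub ((hγ 2).mul hz)).ofReal_comp).mul_const Complex.I
  have hq := (hD.sqrt hDpos.ne').ofReal_comp
  have hs : 0 < √(1 + γ t 1 ^ 2 + γ t 2 ^ 2) := sqrt_pos.2 hDpos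
  have hsC : (√(1 + γ t 1 ^ 2 + γ t 2 ^ 2) : ℂ) ≠ 0 := by exact_mod_cast hs.ne'
  refine ((h1.add h2).div hq hsC).congr_deriv ?_
  have hs2 : ((√(1 + γ t 1 ^ 2 + γ t 2 ^ 2) : ℝ) : ℂ) ^ 2 =
      1 + (γ t 1 : ℂ) ^ 2 + (γ t 2 : ℂ) ^ 2 := by
    rw [← Complex.ofReal_pow, sq_sqrt hDpos.le]; push_cast; rfl
  have hDC : 1 + (γ t 1 : ℂ) ^ 2 + (γ t 2 : ℂ) ^ 2 ≠ 0 := by rw [← hs2]; exact pow_ne_zero 2 hsC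
  simp only [planarVel, planarX, planarY, Pi.add_apply, Pi.mul_apply, Pi.sub_apply, Pi.pow_apply]
  push_cast
  rw [← hs2]
  generalize ((√(1 + γ t 1 ^ 2 + γ t 2 ^ 2) : ℝ) : ℂ) = q at *
  field_simp
  ring_nf
  simp only [Complex.I_sq]
  ring

/-! ### Null geodesics are flows -/

/-- The planar position as a complex number. -/
def planar (p : Event) : ℂ := p 1 + p 2 * Complex.I

/-- The lifted argument of the group element of an event. -/
def liftTime (p : Event) : ℝ := p 0 / √2

/-- The off-diagonal entry of the group element of an event. -/
def shift (p : Event) : ℂ := planar p * Complex.exp (-(liftTime p : ℂ) * Complex.I)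

theorem norm_planar_sq (p : Event) : ‖planar p‖ ^ 2 = p 1 ^ 2 + p 2 ^ 2 := by
  rw [Complex.sq_norm, planar, Complex.normSq_add_mul_I]

theorem norm_exp_neg (x : ℝ) : ‖Complex.exp (-(x : ℂ) * Complex.I)‖ = 1 := by
  rw [← Complex.ofReal_neg, Complex.norm_exp_ofReal_mul_I]

theorem norm_shift_sq (p : Event) : ‖shift p‖ ^ 2 = p 1 ^ 2 + p 2 ^ 2 := by
  rw [shift, norm_mul, norm_exp_neg, mul_one, norm_planar_sq]

theorem norm_shift (p : Event) : ‖shift p‖ = radius p := by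
  rw [radius, ← norm_shift_sq, sqrt_sq (norm_nonneg _)]

theorem amp_event (p : Event) : amp (liftTime p) (shift p) =
    (√(1 + p 1 ^ 2 + p 2 ^ 2) : ℝ) * Complex.exp (liftTime p * Complex.I) := by
  rw [amp, norm_shift_sq, ← add_assoc]

/-- The conserved energy, up to a factor. -/
def energy (p v : Event) : ℝ := v 0 / √2 + p 1 * v 2 - p 2 * v 1

/-- Completing the square in dτ splits the metric as -(dτ + √2(x dy - y dx))² plus a hyperbolic
plane plus dζ². -/
theorem inner4_self (p v : Event) :
    inner4 p v v = -(2 * energy p v ^ 2) + ‖planarVel p v‖ ^ 2 + v 3 ^ 2 := by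
  have h2 : √2 ^ 2 = 2 := sq_sqrt (by norm_num)
  have h2' : √2 ≠ 0 := by positivity
  have hD : 0 < 1 + p 1 ^ 2 + p 2 ^ 2 := by positivity
  rw [planarVel, norm_div, div_pow, Complex.sq_norm, Complex.normSq_add_mul_I, Complex.norm_real,
    norm_eq_abs, sq_abs, sq_sqrt hD.le]
  have he : 2 * energy p v ^ 2 = v 0 ^ 2 + 2 * √2 * v 0 * (p 1 * v 2 - p 2 * v 1) +
      2 * (p 1 * v 2 - p 2 * v 1) ^ 2 := by
    rw [energy]
    field_simp
    ring_nf
    simp only [h2, show √2 ^ 3 = 2 * √2 by rw [pow_succ, h2]]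
    ring
  rw [he]
  simp [inner4, metric, Fin.sum_univ_four]
  field_simp
  ring

theorem inner4_time (p v : Event) :
    inner4 p (Pi.single 0 1) v = -(√2 * energy p v) := by
  have h2' : √2 ≠ 0 := by positivity
  simp [inner4, metric, Fin.sum_univ_four, energy]
  field_simp
  ring

theorem shift_mul_conj_div_amp (p v : Event) :
    shift p * conj (planarVel p v * Complex.exp (-(2 * liftTime p : ℝ) * Complex.I)) /
      amp (liftTime p) (shift p) = planar p * conj (planarVel p v) /
        (√(1 + p 1 ^ 2 + p 2 ^ 2) : ℝ) := by
  have hexp := Complex.exp_ne_zero (liftTime p * Complex.I)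
  have hD : 0 < 1 + p 1 ^ 2 + p 2 ^ 2 := by positivity
  have hs : (√(1 + p 1 ^ 2 + p 2 ^ 2) : ℂ) ≠ 0 := by exact_mod_cast (sqrt_pos.2 hD).ne'
  rw [amp_event, shift, map_mul, ← Complex.exp_conj]
  simp only [map_mul, map_neg, Complex.conj_ofReal, Complex.conj_I]
  rw [div_eq_div_iff (mul_ne_zero hs hexp) hs]
  have e : Complex.exp (-(liftTime p : ℂ) * Complex.I) *
      Complex.exp (-((2 * liftTime p : ℝ) : ℂ) * -Complex.I) =
      Complex.exp (liftTime p * Complex.I) := by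
    rw [← Complex.exp_add]; congr 1; push_cast; ring
  linear_combination planar p * conj (planarVel p v) * (√(1 + p 1 ^ 2 + p 2 ^ 2) : ℝ) * e

theorem im_planar_mul_conj_div (p v : Event) :
    (planar p * conj (planarVel p v) / (√(1 + p 1 ^ 2 + p 2 ^ 2) : ℝ)).im =
      -(p 1 * v 2 - p 2 * v 1) := by
  have hD : 0 < 1 + p 1 ^ 2 + p 2 ^ 2 := by positivity
  have hs : √(1 + p 1 ^ 2 + p 2 ^ 2) ≠ 0 := (sqrt_pos.2 hD).ne'
  have hs2 : √(1 + p 1 ^ 2 + p 2 ^ 2) ^ 2 = 1 + p 1 ^ 2 + p 2 ^ 2 := sq_sqrt hD.le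
  have key : ∀ x y A B : ℝ, ((x + y * Complex.I : ℂ) * conj (A + B * Complex.I : ℂ)).im =
      y * A - x * B := fun x y A B => by simp; ring
  rw [planarVel, planar, map_div₀, Complex.conj_ofReal, mul_div_assoc', div_div,
    ← Complex.ofReal_mul, Complex.div_ofReal_im, ← sq, hs2, key]
  field_simp
  ring

theorem exists_isFlow {γ : ℝ → Event} (h : IsFutureNullGeodesic γ) :
    ∃ η σ, 0 < η ∧ IsFlow η σ (fun t => liftTime (γ t)) (fun t => shift (γ t)) := by
  obtain ⟨v, a, h⟩ := h
  have h2 : √2 ^ 2 = 2 := sq_sqrt (by norm_num)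
  have h2' : √2 ≠ 0 := by positivity
  have hmem : (0 : ℝ) ∈ Icc (0 : ℝ) 1 := left_mem_Icc.2 zero_le_one
  have hgeo : ∀ t ∈ Icc (0 : ℝ) 1, _ := fun t ht =>
    (geodesicForm_eq_zero_iff (γ t) (v t) (a t)).1 (h t ht).2.2.1
  set η := energy (γ 0) (v 0) with hη
  have hη0 : 0 < η := by
    have := (h 0 hmem).2.2.2.2
    rw [inner4_time, neg_lt_zero] at this
    exact pos_of_mul_pos_right this (sqrt_nonneg _)
  have hE : ∀ t ∈ Icc (0 : ℝ) 1, energy (γ t) (v t) = η := fun t ht => by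
    refine eq_zero_of_hasDerivWithinAt_zero (f := fun t => energy (γ t) (v t)) (fun t ht => ?_) ht
    have hγ := hasDerivWithinAt_pi.1 (h t ht).1
    have hv := hasDerivWithinAt_pi.1 (h t ht).2.1
    refine ((((hv 0).div_const √2).add ((hγ 1).mul (hv 2))).sub ((hγ 2).mul (hv 1))).congr_deriv ?_
    have := (hgeo t ht).1
    field_simp
    linear_combination -this
  -- The factor e^{-2iα} lowers the rotation rate by 2α', leaving twice the conserved energy: S is
  -- the shear of the flow.
  set S : ℝ → ℂ := fun t => planarVel (γ t) (v t) *
    Complex.exp (-(2 * liftTime (γ t) : ℝ) * Complex.I) with hS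
  have hS' : ∀ t ∈ Icc (0 : ℝ) 1,
      HasDerivWithinAt S (2 * η * Complex.I * S t) (Icc 0 1) t := fun t ht => by
    have h1 := hasDerivWithinAt_planarVel (h t ht).1 (h t ht).2.1
    have hγ := hasDerivWithinAt_pi.1 (h t ht).1
    have h3 : HasDerivWithinAt (fun t => -((2 * liftTime (γ t) : ℝ) : ℂ) * Complex.I)
        (-((2 * (v t 0 / √2) : ℝ) : ℂ) * Complex.I) (Icc 0 1) t :=
      (((hγ 0).div_const √2).const_mul 2).ofReal_comp.neg.mul_const Complex.I
    refine (h1.mul h3.cexp).congr_deriv ?_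
    rw [(hgeo t ht).2.1, (hgeo t ht).2.2.1, ← hE t ht, hS]
    have hv0 : √2 * v t 0 = 2 * (v t 0 / √2) := by field_simp; linear_combination v t 0 * h2
    simp only [energy, hv0]
    push_cast
    ring
  have hD : ∀ t, 0 < 1 + γ t 1 ^ 2 + γ t 2 ^ 2 := fun t => by positivity
  have hshear : ∀ t ∈ Icc (0 : ℝ) 1, shear η (S 0) t = S t := fun t ht => by
    have hc := eq_zero_of_hasDerivWithinAt_zero (f := fun t => S t * shear (-η) 1 t)
      (fun t ht => ((hS' t ht).mul (hasDerivAt_shear (-η) 1 t).hasDerivWithinAt).congr_deriv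
        (by push_cast; ring)) ht
    simp only [shear, one_mul, mul_zero, Complex.ofReal_zero, zero_mul, Complex.exp_zero,
      mul_one] at hc
    rw [shear, ← hc, mul_assoc, ← Complex.exp_add, ← add_mul, ← Complex.ofReal_add]
    simp
  refine ⟨η, S 0, hη0, hη0.le, ?_, fun t ht => ?_, fun t ht => ?_⟩
  · have h4 := (h 0 hmem).2.2.2.1
    rw [inner4_self] at h4
    have h5 : ‖S 0‖ = ‖planarVel (γ 0) (v 0)‖ := by
      rw [hS, norm_mul, norm_exp_neg, mul_one]
    rw [h5]
    nlinarith [sq_nonneg (v 0 3)]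
  · have hγ := hasDerivWithinAt_pi.1 (h t ht).1
    refine ((hγ 0).div_const √2).congr_deriv ?_
    rw [hshear t ht, hS, shift_mul_conj_div_amp, im_planar_mul_conj_div, ← hE t ht, energy]
    ring
  · have hγ := hasDerivWithinAt_pi.1 (h t ht).1
    have h3 : HasDerivWithinAt (fun t => -(liftTime (γ t) : ℂ) * Complex.I)
        (-((v t 0 / √2 : ℝ) : ℂ) * Complex.I) (Icc 0 1) t :=
      ((hγ 0).div_const √2).ofReal_comp.neg.mul_const Complex.I
    have h4 : HasDerivWithinAt (fun t => planar (γ t)) (v t 1 + v t 2 * Complex.I) (Icc 0 1) t :=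
      (hγ 1).ofReal_comp.add ((hγ 2).ofReal_comp.mul_const Complex.I)
    refine (h4.mul h3.cexp).congr_deriv ?_
    have hs : (√(1 + γ t 1 ^ 2 + γ t 2 ^ 2) : ℂ) ≠ 0 := by exact_mod_cast (sqrt_pos.2 (hD t)).ne'
    rw [hshear t ht, hS, amp_event, ← hE t ht]
    have e : Complex.exp (liftTime (γ t) * Complex.I) *
        Complex.exp (-((2 * liftTime (γ t) : ℝ) : ℂ) * Complex.I) =
        Complex.exp (-(liftTime (γ t) : ℂ) * Complex.I) := by
      rw [← Complex.exp_add]; congr 1; push_cast; ring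
    have e' : ((√(1 + γ t 1 ^ 2 + γ t 2 ^ 2) : ℝ) : ℂ) * Complex.exp (liftTime (γ t) * Complex.I) *
        (planarVel (γ t) (v t) * Complex.exp (-((2 * liftTime (γ t) : ℝ) : ℂ) * Complex.I)) =
        ((√(1 + γ t 1 ^ 2 + γ t 2 ^ 2) : ℝ) : ℂ) * planarVel (γ t) (v t) *
          Complex.exp (-(liftTime (γ t) : ℂ) * Complex.I) := by rw [← e]; ring
    simp only [e']
    rw [planarVel, mul_div_cancel₀ _ hs, shift, planar, energy]
    push_cast
    generalize Complex.exp (-(liftTime (γ t) : ℂ) * Complex.I) = E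
    linear_combination (E * γ t 2 * (γ t 1 * v t 2 - γ t 2 * v t 1)) * Complex.I_sq

/-! ### Extremal flows are planar null geodesics -/

/-- The event with given group coordinates and `ζ = 0`. -/
def toEvent (α : ℝ) (b : ℂ) : Event :=
  ![√2 * α, (b * Complex.exp (α * Complex.I)).re, (b * Complex.exp (α * Complex.I)).im, 0]

theorem liftTime_toEvent (α : ℝ) (b : ℂ) : liftTime (toEvent α b) = α := by
  have : √2 ≠ 0 := by positivity
  simp [liftTime, toEvent, this]

theorem shift_toEvent (α : ℝ) (b : ℂ) : shift (toEvent α b) = b := by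
  rw [shift, liftTime_toEvent, planar]
  change (((b * Complex.exp (α * Complex.I)).re : ℂ) +
    ((b * Complex.exp (α * Complex.I)).im : ℂ) * Complex.I) * _ = b
  rw [Complex.re_add_im, mul_assoc, ← Complex.exp_add]
  simp

theorem radius_toEvent (α : ℝ) (b : ℂ) : radius (toEvent α b) = ‖b‖ := by
  rw [← norm_shift, shift_toEvent]

theorem toEvent_zero : toEvent 0 0 = origin := by
  ext i; fin_cases i <;> simp [toEvent, origin]

theorem planarVel_eq {p v : Event} {S : ℂ} {j : ℝ}
    (hj : j * √(1 + p 1 ^ 2 + p 2 ^ 2) = p 1 * S.im - p 2 * S.re)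
    (h1 : v 1 = √(1 + p 1 ^ 2 + p 2 ^ 2) * S.re + j * p 2)
    (h2 : v 2 = √(1 + p 1 ^ 2 + p 2 ^ 2) * S.im - j * p 1) :
    planarVel p v = S ∧ p 1 * v 2 - p 2 * v 1 = j := by
  have hD : 0 < 1 + p 1 ^ 2 + p 2 ^ 2 := by positivity
  have hq2 : √(1 + p 1 ^ 2 + p 2 ^ 2) ^ 2 = 1 + p 1 ^ 2 + p 2 ^ 2 := sq_sqrt hD.le
  have hq : √(1 + p 1 ^ 2 + p 2 ^ 2) ≠ 0 := (sqrt_pos.2 hD).ne'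
  have hqC : (√(1 + p 1 ^ 2 + p 2 ^ 2) : ℂ) ≠ 0 := by exact_mod_cast hq
  have hmain : p 1 * v 2 - p 2 * v 1 = j := by
    rw [h1, h2]
    linear_combination -√(1 + p 1 ^ 2 + p 2 ^ 2) * hj + j * hq2
  refine ⟨?_, hmain⟩
  rw [planarVel, div_eq_iff hqC]
  have e1 : (1 + p 1 ^ 2 + p 2 ^ 2) * v 1 - p 1 * (p 1 * v 1 + p 2 * v 2) =
      √(1 + p 1 ^ 2 + p 2 ^ 2) * S.re := by
    linear_combination h1 - p 2 * hmain
  have e2 : (1 + p 1 ^ 2 + p 2 ^ 2) * v 2 - p 2 * (p 1 * v 1 + p 2 * v 2) =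
      √(1 + p 1 ^ 2 + p 2 ^ 2) * S.im := by
    linear_combination h2 + p 1 * hmain
  simp only [e1, e2]
  conv_rhs => rw [← Complex.re_add_im S]
  push_cast
  ring

theorem IsFlow.isFutureNullGeodesic {η : ℝ} {σ : ℂ} {α : ℝ → ℝ} {b : ℝ → ℂ}
    (h : IsFlow η σ α b) (hη : 0 < η) (hσ : ‖σ‖ ^ 2 = 2 * η ^ 2) :
    IsFutureNullGeodesic fun t => toEvent (α t) (b t) := by
  have h2 : √2 * √2 = 2 := mul_self_sqrt (by norm_num)
  have h2' : √2 ≠ 0 := by positivity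
  have huniq : UniqueDiffOn ℝ (Icc (0 : ℝ) 1) := uniqueDiffOn_Icc zero_lt_one
  set α' : ℝ → ℝ := fun t => η + (b t * conj (shear η σ t) / amp (α t) (b t)).im with hα'
  set w' : ℝ → ℂ := fun t => (amp (α t) (b t) * shear η σ t - η * Complex.I * b t) *
    Complex.exp (α t * Complex.I) + b t * (Complex.exp (α t * Complex.I) * (α' t * Complex.I))
    with hw'
  set v : ℝ → Event := fun t => ![√2 * α' t, (w' t).re, (w' t).im, 0] with hv
  have hexp : ∀ t ∈ Icc (0 : ℝ) 1, HasDerivWithinAt (fun t => Complex.exp (α t * Complex.I))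
      (Complex.exp (α t * Complex.I) * (α' t * Complex.I)) (Icc 0 1) t := fun t ht =>
    ((h.hasDeriv_time t ht).ofReal_comp.mul_const Complex.I).cexp
  have hdγ : ∀ t ∈ Icc (0 : ℝ) 1,
      HasDerivWithinAt (fun t => toEvent (α t) (b t)) (v t) (Icc 0 1) t := fun t ht => by
    have hw := (h.hasDeriv_shift t ht).mul (hexp t ht)
    rw [hasDerivWithinAt_pi]
    intro i
    fin_cases i
    exacts [(h.hasDeriv_time t ht).const_mul √2, hasDerivWithinAt_re hw, hasDerivWithinAt_im hw,
      hasDerivWithinAt_const _ _ _]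
  have hdv : ∀ t ∈ Icc (0 : ℝ) 1, HasDerivWithinAt v (derivWithin v (Icc 0 1) t) (Icc 0 1) t := by
    intro t ht
    have hb := h.hasDeriv_shift t ht
    have ha := h.hasDeriv_amp ht
    have hs := (hasDerivAt_shear η σ t).hasDerivWithinAt (s := Icc 0 1)
    have d0 := (hasDerivWithinAt_im ((hb.mul (hasDerivWithinAt_conj hs)).div ha
      (amp_ne_zero _ _))).const_add η
    have d1 := (((ha.mul hs).sub (hb.const_mul (η * Complex.I))).mul (hexp t ht)).add
      (hb.mul ((hexp t ht).mul (d0.ofReal_comp.mul_const Complex.I)))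
    have d2 := hasDerivWithinAt_re d1
    have d3 := hasDerivWithinAt_im d1
    refine DifferentiableWithinAt.hasDerivWithinAt ?_
    rw [differentiableWithinAt_pi]
    intro i
    fin_cases i
    exacts [(d0.const_mul √2).differentiableWithinAt, d2.differentiableWithinAt,
      d3.differentiableWithinAt, differentiableWithinAt_const _]
  set S : ℝ → ℂ := fun t => shear η σ t * Complex.exp ((2 * α t : ℝ) * Complex.I) with hS
  have hvel : ∀ t, planarVel (toEvent (α t) (b t)) (v t) = S t ∧
      toEvent (α t) (b t) 1 * v t 2 - toEvent (α t) (b t) 2 * v t 1 = η - α' t := by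
    intro t
    have hD : 1 + toEvent (α t) (b t) 1 ^ 2 + toEvent (α t) (b t) 2 ^ 2 = 1 + ‖b t‖ ^ 2 := by
      rw [add_assoc, ← norm_shift_sq, shift_toEvent]
    set q := √(1 + ‖b t‖ ^ 2) with hq
    have hq0 : (q : ℂ) ≠ 0 := by
      have : 0 < q := by positivity
      exact_mod_cast this.ne'
    have hexp0 := Complex.exp_ne_zero (α t * Complex.I)
    have hee : Complex.exp (((2 * α t : ℝ) : ℂ) * Complex.I) =
        Complex.exp (α t * Complex.I) * Complex.exp (α t * Complex.I) := by
      rw [← Complex.exp_add]; congr 1; push_cast; ring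
    have hce : conj (Complex.exp (α t * Complex.I)) * Complex.exp (α t * Complex.I) = 1 := by
      rw [Complex.conj_mul', Complex.norm_exp_ofReal_mul_I]; simp
    have hS2 : b t * conj (shear η σ t) / amp (α t) (b t) * q =
        b t * Complex.exp (α t * Complex.I) * conj (S t) := by
      rw [amp, ← hq, div_mul_eq_mul_div, div_eq_iff (mul_ne_zero hq0 hexp0), hS]
      simp only [hee, map_mul]
      linear_combination (-(b t * conj (shear η σ t) * q) *
        (1 + conj (Complex.exp (α t * Complex.I)) * Complex.exp (α t * Complex.I))) * hce
    have hwS : w' t = q * S t - (η - α' t : ℝ) * (Complex.I *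
        (b t * Complex.exp (α t * Complex.I))) := by
      simp only [hw', hS, hee, amp, ← hq]
      push_cast
      ring
    refine planarVel_eq ?_ ?_ ?_
    · rw [hD, ← hq]
      have := congrArg Complex.im hS2
      rw [Complex.im_mul_ofReal] at this
      have e : η - α' t = -(b t * conj (shear η σ t) / amp (α t) (b t)).im := by
        simp only [hα']; ring
      rw [e, neg_mul, this, Complex.mul_im, Complex.conj_re, Complex.conj_im]
      simp only [toEvent]
      change -((b t * Complex.exp (α t * Complex.I)).re * _ +
        (b t * Complex.exp (α t * Complex.I)).im * _) = (b t * Complex.exp (α t * Complex.I)).re * _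
          - (b t * Complex.exp (α t * Complex.I)).im * _
      ring
    · rw [hD]
      change (w' t).re = _ + _ * (b t * Complex.exp (α t * Complex.I)).im
      rw [hwS, Complex.sub_re, Complex.re_ofReal_mul, Complex.re_ofReal_mul, Complex.I_mul_re]
      ring
    · rw [hD]
      change (w' t).im = _ - _ * (b t * Complex.exp (α t * Complex.I)).re
      rw [hwS, Complex.sub_im, Complex.im_ofReal_mul, Complex.im_ofReal_mul, Complex.I_mul_im]
  have hv0 : ∀ t, v t 0 / √2 = α' t := fun t => by
    change √2 * α' t / √2 = α' t
    field_simp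
  have henergy : ∀ t, energy (toEvent (α t) (b t)) (v t) = η := fun t => by
    rw [energy, add_sub_assoc, (hvel t).2, hv0]; ring
  refine ⟨v, fun t => derivWithin v (Icc 0 1) t, fun t ht => ⟨hdγ t ht, hdv t ht, ?_, ?_, ?_⟩⟩
  · change ∀ k, geodesicForm (toEvent (α t) (b t)) (v t) (derivWithin v (Icc 0 1) t) k = 0
    have hγi := hasDerivWithinAt_pi.1 (hdγ t ht)
    have hvi := hasDerivWithinAt_pi.1 (hdv t ht)
    generalize derivWithin v (Icc 0 1) t = a at hvi ⊢
    have hplanar := hasDerivWithinAt_planarVel (hdγ t ht) (hasDerivWithinAt_pi.2 hvi)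
    simp only [fun t => (hvel t).1] at hplanar
    have hS' : HasDerivWithinAt S (2 * (η + α' t : ℝ) * Complex.I * S t) (Icc 0 1) t := by
      have h3 : HasDerivWithinAt (fun t => ((2 * α t : ℝ) : ℂ) * Complex.I)
          (((2 * α' t : ℝ) : ℂ) * Complex.I) (Icc 0 1) t :=
        ((h.hasDeriv_time t ht).const_mul 2).ofReal_comp.mul_const Complex.I
      refine ((hasDerivAt_shear η σ t).hasDerivWithinAt.mul h3.cexp).congr_deriv ?_
      simp only [hS]; push_cast; ring
    -- The planar velocity is S, differentiated in two ways; the difference is the planar defect,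
    -- which must vanish.
    have huq := (huniq t ht).eq_deriv _ hplanar hS'
    have hv0' : √2 * v t 0 = 2 * α' t := by
      rw [← hv0 t]; field_simp; linear_combination v t 0 * h2
    rw [(hvel t).2, hv0', show 2 * α' t + (η - α' t) = η + α' t by ring, add_eq_right] at huq
    have hD : 0 < 1 + toEvent (α t) (b t) 1 ^ 2 + toEvent (α t) (b t) 2 ^ 2 := by positivity
    rw [div_eq_zero_iff] at huq
    have hzero := huq.resolve_right (by exact_mod_cast (sqrt_pos.2 hD).ne')
    refine (geodesicForm_eq_zero_iff (toEvent (α t) (b t)) (v t) a).2 ⟨?_, ?_, ?_, ?_⟩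
    · have hE := (((hvi 0).div_const √2).add ((hγi 1).mul (hvi 2))).sub ((hγi 2).mul (hvi 1))
      have hE' : HasDerivWithinAt (fun t => energy (toEvent (α t) (b t)) (v t)) 0 (Icc 0 1) t := by
        simp only [henergy]; exact hasDerivWithinAt_const _ _ _
      have := (huniq t ht).eq_deriv _ hE hE'
      field_simp at this
      linear_combination -this
    · simpa using congrArg Complex.re hzero
    · simpa using congrArg Complex.im hzero
    · exact (huniq t ht).eq_deriv _ (hvi 3) (hasDerivWithinAt_const t _ (0 : ℝ))
  · have : v t 3 = 0 := rfl
    rw [inner4_self, henergy, (hvel t).1, this, hS, norm_mul, norm_shear,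
      Complex.norm_exp_ofReal_mul_I, mul_one, hσ]
    ring
  · rw [inner4_time, henergy]
    have : 0 < √2 := by positivity
    linarith [mul_pos this hη]

/-! ### Half circles and the optimal path -/

/-- The half circle from the origin to the horizon. -/
theorem isFlow_halfCircle {u : ℂ} (hu : ‖u‖ = 1) :
    IsFlow (π / (2 * √2)) ((π / 2 : ℝ) * u) (fun t => profile (sin (π / 2 * t)))
      (fun t => u * sin (π / 2 * t) * Complex.exp ((π / (2 * √2) * t : ℝ) * Complex.I)) := by
  have h2 : √2 ^ 2 = 2 := sq_sqrt (by norm_num)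
  have h2' : √2 ≠ 0 := by positivity
  have hpi := pi_pos
  set η := π / (2 * √2) with hη
  have hηω : √2 * (π / 2) = 2 * η := by rw [hη]; field_simp; linear_combination h2
  have hηω' : √2 * η = π / 2 := by rw [hη]; field_simp
  have hξ : ∀ t ∈ Icc (0 : ℝ) 1, 0 ≤ π / 2 * t ∧ π / 2 * t ≤ π / 2 := fun t ht =>
    ⟨by nlinarith [ht.1], by nlinarith [ht.2]⟩
  have hnorm : ∀ t : ℝ, ‖u * sin (π / 2 * t) * Complex.exp ((η * t : ℝ) * Complex.I)‖ ^ 2 =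
      sin (π / 2 * t) ^ 2 := fun t => by
    rw [norm_mul, norm_mul, hu, Complex.norm_exp_ofReal_mul_I, one_mul, mul_one,
      Complex.norm_real, norm_eq_abs, sq_abs]
  have hamp : ∀ t ∈ Icc (0 : ℝ) 1, amp (profile (sin (π / 2 * t)))
      (u * sin (π / 2 * t) * Complex.exp ((η * t : ℝ) * Complex.I)) =
      (cos (π / 2 * t) + √2 * sin (π / 2 * t) * Complex.I) *
        Complex.exp (-((η * t : ℝ) : ℂ) * Complex.I) := fun t ht => by
    rw [amp, hnorm, exp_profile_sin (hξ t ht).1 (hξ t ht).2]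
    congr 4
    rw [hη]; push_cast; field_simp
  have hlin : ∀ c t : ℝ, HasDerivAt (fun t : ℝ => c * t) c t := fun c t => by
    simpa using (hasDerivAt_id t).const_mul c
  refine ⟨by positivity, ?_, fun t ht => ?_, fun t ht => ?_⟩
  · rw [norm_mul, hu, mul_one, Complex.norm_real, norm_eq_abs, sq_abs, ← hηω', mul_pow, h2]
  · have hd := ((hasDerivAt_profile _).comp t ((hasDerivAt_sin _).comp t (hlin (π / 2) t)))
    refine hd.hasDerivWithinAt.congr_deriv ?_
    have hc : 0 ≤ cos (π / 2 * t) :=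
      cos_nonneg_of_mem_Icc ⟨by linarith [(hξ t ht).1], (hξ t ht).2⟩
    have hcs : √(1 - sin (π / 2 * t) ^ 2) = cos (π / 2 * t) := by
      rw [← cos_sq', sqrt_sq hc]
    have hX := IsFlow.im_div_amp (shear η ((π / 2 : ℝ) * u) t) (profile (sin (π / 2 * t)))
      (u * sin (π / 2 * t) * Complex.exp ((η * t : ℝ) * Complex.I))
    rw [hnorm, hamp t ht] at hX
    rw [hamp t ht]
    have e : conj (u * sin (π / 2 * t) * Complex.exp ((η * t : ℝ) * Complex.I)) *
        ((cos (π / 2 * t) + √2 * sin (π / 2 * t) * Complex.I) *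
          Complex.exp (-((η * t : ℝ) : ℂ) * Complex.I)) * shear η ((π / 2 : ℝ) * u) t =
        ((sin (π / 2 * t) * (π / 2) : ℝ) : ℂ) * ((cos (π / 2 * t) : ℂ) +
          ((√2 * sin (π / 2 * t) : ℝ) : ℂ) * Complex.I) := by
      have hcu : conj u * u = 1 := by rw [Complex.conj_mul', hu]; simp
      have hee : Complex.exp (((η * t : ℝ) : ℂ) * -Complex.I) *
          Complex.exp (-((η * t : ℝ) : ℂ) * Complex.I) *
          Complex.exp (((2 * η * t : ℝ) : ℂ) * Complex.I) = 1 := by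
        rw [← Complex.exp_add, ← Complex.exp_add, ← Complex.exp_zero]
        congr 1; push_cast; ring
      simp only [shear, map_mul, ← Complex.exp_conj, Complex.conj_ofReal, Complex.conj_I]
      generalize Complex.exp (((η * t : ℝ) : ℂ) * -Complex.I) = E1 at hee ⊢
      generalize Complex.exp (-((η * t : ℝ) : ℂ) * Complex.I) = E2 at hee ⊢
      generalize Complex.exp (((2 * η * t : ℝ) : ℂ) * Complex.I) = E3 at hee ⊢
      push_cast
      generalize Complex.sin (π / 2 * t) = s
      generalize Complex.cos (π / 2 * t) = c
      linear_combination (s * (π / 2) * (c + √2 * s * Complex.I)) * (E1 * E2 * E3 * hcu + hee)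
    rw [e, Complex.im_ofReal_mul] at hX
    have him : ((cos (π / 2 * t) : ℂ) + ((√2 * sin (π / 2 * t) : ℝ) : ℂ) * Complex.I).im =
        √2 * sin (π / 2 * t) := by
      simp only [Complex.add_im, Complex.ofReal_im, Complex.im_ofReal_mul, Complex.I_im]; ring
    rw [him] at hX
    have hq : 0 < 1 + sin (π / 2 * t) ^ 2 := by positivity
    rw [Function.comp_apply, hcs]
    refine mul_left_cancel₀ hq.ne' ?_
    rw [mul_add (1 + sin (π / 2 * t) ^ 2) η, hX]
    have hc2 := cos_sq' (π / 2 * t)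
    generalize cos (π / 2 * t) = c at hc2 ⊢
    generalize sin (π / 2 * t) = s at hc2 hq ⊢
    have e1 : (1 + s ^ 2) * (c / (√2 * (1 + s ^ 2)) * (c * (π / 2))) = c ^ 2 * η := by
      rw [hη]; field_simp
    rw [e1, hc2]
    linear_combination s ^ 2 * hηω
  · have hd := (((hasDerivAt_sin _).comp t (hlin (π / 2) t)).ofReal_comp.const_mul u).mul
      (((hlin η t).ofReal_comp.mul_const Complex.I).cexp)
    refine hd.hasDerivWithinAt.congr_deriv ?_
    rw [hamp t ht]
    have hee : Complex.exp (-((η * t : ℝ) : ℂ) * Complex.I) *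
        Complex.exp (((2 * η * t : ℝ) : ℂ) * Complex.I) =
        Complex.exp (((η * t : ℝ) : ℂ) * Complex.I) := by
      rw [← Complex.exp_add]
      congr 1; push_cast; ring
    have hC : (√2 : ℂ) * (π / 2) = 2 * η := by exact_mod_cast hηω
    simp only [shear, Function.comp_apply]
    generalize Complex.exp (-((η * t : ℝ) : ℂ) * Complex.I) = E2 at hee ⊢
    generalize Complex.exp (((2 * η * t : ℝ) : ℂ) * Complex.I) = E3 at hee ⊢
    generalize Complex.exp (((η * t : ℝ) : ℂ) * Complex.I) = E1 at hee ⊢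
    push_cast
    generalize Complex.sin (π / 2 * t) = s
    generalize Complex.cos (π / 2 * t) = c
    linear_combination (-(c + √2 * s * Complex.I) * (π / 2) * u) * hee - s * Complex.I * u * E1 * hC

/-- From every event there are planar null half circles in all directions. -/
theorem exists_halfCircle (α : ℝ) (b : ℂ) {B : ℂ} (hB : ‖B‖ = 1) :
    ∃ γ, IsFutureNullGeodesic γ ∧ γ 0 = toEvent α b ∧
      γ 1 = toEvent (mulTime α b (profile 1) B) (mulShift α b (profile 1) B) := by
  set η := π / (2 * √2) with hη
  -- The half circle turns its shift by e^{iη}; starting from u makes it end at B.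
  set u := B * Complex.exp ((-η : ℝ) * Complex.I) with hu
  have hu1 : ‖u‖ = 1 := by rw [hu, norm_mul, hB, Complex.norm_exp_ofReal_mul_I, one_mul]
  have h2 : √2 ^ 2 = 2 := sq_sqrt (by norm_num)
  have hflow := (isFlow_halfCircle hu1).mul α b
  refine ⟨_, hflow.isFutureNullGeodesic (by positivity) ?_, ?_, ?_⟩
  · rw [norm_mul, hu1, mul_one, Complex.norm_real, norm_eq_abs, sq_abs, div_pow, div_pow, mul_pow,
      h2]
    ring
  · simp [mulTime, mulShift, amp_zero]
  · have e : u * Complex.exp ((η : ℂ) * Complex.I) = B := by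
      rw [hu, mul_assoc, ← Complex.exp_add, ← add_mul, ← Complex.ofReal_add]; simp
    simp only [mul_one, sin_pi_div_two, Complex.ofReal_one, ← hη, e]

/-- The equality case p = q = d of the hexagon bound. -/
theorem arg_optimal_hexagon {d : ℂ} (hd : d = -1 / 4 - √15 / 4 * Complex.I) :
    (1 + d + d ^ 2 / 2).arg = -arctan (3 * √(3 / 5)) := by
  have h15 : √15 ^ 2 = 15 := sq_sqrt (by norm_num)
  have h15C : (√15 : ℂ) ^ 2 = 15 := by exact_mod_cast h15
  have e : 1 + d + d ^ 2 / 2 = ⟨5 / 16, -(3 * √15 / 16)⟩ := by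
    have : (⟨5 / 16, -(3 * √15 / 16)⟩ : ℂ) =
        ((5 / 16 : ℝ) : ℂ) + ((-(3 * √15 / 16) : ℝ) : ℂ) * Complex.I := Complex.mk_eq_add_mul_I _ _
    rw [this, hd]
    push_cast
    linear_combination (Complex.I ^ 2 / 32) * h15C + (15 / 32) * Complex.I_sq
  have hre : 0 < (1 + d + d ^ 2 / 2).re := by rw [e]; norm_num
  have h := arg_mem_Ioo_of_re_pos hre
  rw [← arctan_tan h.1 h.2, Complex.tan_arg, ← arctan_neg, e]
  congr 1
  have h35 : √(3 / 5) = √15 / 5 := by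
    rw [sqrt_eq_iff_mul_self_eq (by norm_num) (by positivity)]
    linear_combination -h15 / 25
  simp only [h35]
  ring

theorem sqrt_two_mul_liftTime (p : Event) : √2 * liftTime p = tau p := by
  have : √2 ≠ 0 := by positivity
  rw [liftTime, tau]; field_simp

/-- A path with three planar half circles that attains the least time. -/
theorem exists_optimal_path : ∃ p : LightlikePath 3, p.source = origin ∧
    radius (p.node 1) = 1 ∧ tauMin = tau p.target := by
  set ε := Complex.exp (profile 1 * Complex.I) with hε
  have hε1 : ‖ε‖ = 1 := Complex.norm_exp_ofReal_mul_I _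
  have hε0 : ε ≠ 0 := Complex.exp_ne_zero _
  have hεc : ε * conj ε = 1 := by rw [Complex.mul_conj', hε1]; simp
  set d : ℂ := -1 / 4 - √15 / 4 * Complex.I with hd
  have h15 : √15 ^ 2 = 15 := sq_sqrt (by norm_num)
  have hd1 : ‖d‖ = 1 := by
    have e : d = ((-1 / 4 : ℝ) : ℂ) + ((-√15 / 4 : ℝ) : ℂ) * Complex.I := by
      rw [hd]; push_cast; ring
    rw [← sq_eq_sq₀ (norm_nonneg _) zero_le_one, Complex.sq_norm, e, Complex.normSq_add_mul_I]
    linear_combination h15 / 16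
  have hdc : d * conj d = 1 := by rw [Complex.mul_conj', hd1]; simp
  have hampB : ∀ B : ℂ, ‖B‖ = 1 → amp (profile 1) B = √2 * ε := fun B hB => by
    rw [amp, hB, hε]; norm_num
  -- The phases are chosen so that the powers of ε cancel and the two correction factors multiply to
  -- 1 + d + d²/2.
  set B₂ := conj (d * ε) with hB₂
  set B₃ := conj (d ^ 2 * ε ^ 3) with hB₃
  have hB₂1 : ‖B₂‖ = 1 := by rw [hB₂, Complex.norm_conj, norm_mul, hd1, hε1, one_mul]
  have hB₃1 : ‖B₃‖ = 1 := by
    rw [hB₃, Complex.norm_conj, norm_mul, norm_pow, norm_pow, hd1, hε1]; norm_num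
  have hP₁ : mulTime 0 0 (profile 1) ε = profile 1 ∧ mulShift 0 0 (profile 1) ε = ε := by
    constructor <;> simp [mulTime, mulShift, amp_zero]
  obtain ⟨γ₁, g₁, s₁, t₁⟩ := exists_halfCircle 0 0 hε1
  rw [hP₁.1, hP₁.2] at t₁
  obtain ⟨γ₂, g₂, s₂, t₂⟩ := exists_halfCircle (profile 1) ε hB₂1
  set α₂ := mulTime (profile 1) ε (profile 1) B₂ with hα₂
  set b₂ := mulShift (profile 1) ε (profile 1) B₂ with hb₂
  obtain ⟨γ₃, g₃, s₃, t₃⟩ := exists_halfCircle α₂ b₂ hB₃1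
  refine ⟨⟨![toEvent 0 0, toEvent (profile 1) ε, toEvent α₂ b₂,
    toEvent (mulTime α₂ b₂ (profile 1) B₃) (mulShift α₂ b₂ (profile 1) B₃)], ![γ₁, γ₂, γ₃],
    ?_, ?_, ?_⟩, toEvent_zero, ?_, ?_⟩
  · intro i; fin_cases i; exacts [g₁, g₂, g₃]
  · intro i; fin_cases i; exacts [s₁, s₂, s₃]
  · intro i; fin_cases i; exacts [t₁, t₂, t₃]
  · change radius (toEvent (profile 1) ε) = 1
    rw [radius_toEvent, hε1]
  · change tauMin = tau (toEvent (mulTime α₂ b₂ (profile 1) B₃) (mulShift α₂ b₂ (profile 1) B₃))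
    rw [← sqrt_two_mul_liftTime, liftTime_toEvent, tauMin_eq]
    congr 1
    have n₁ := norm_mul_conj_div_lt_one (profile 1) ε (profile 1) B₂
    have n₂ := norm_mul_conj_div_lt_one α₂ b₂ (profile 1) B₃
    have harg := arg_mul_of_re_pos (re_one_add_pos n₁) (re_one_add_pos n₂)
    have ha₂ : amp α₂ b₂ = amp (profile 1) ε * amp (profile 1) B₂ + ε * conj B₂ := amp_mul _ _ _ _
    have ha₂0 := amp_ne_zero α₂ b₂
    have h2 : (√2 : ℂ) ^ 2 = 2 := by exact_mod_cast sq_sqrt (by norm_num : (0 : ℝ) ≤ 2)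
    have h20 : (√2 : ℂ) ≠ 0 := fun h => by simp [h] at h2
    have e : (1 + ε * conj B₂ / (amp (profile 1) ε * amp (profile 1) B₂)) *
        (1 + b₂ * conj B₃ / (amp α₂ b₂ * amp (profile 1) B₃)) = 1 + d + d ^ 2 / 2 := by
      have hcB₂ : conj B₂ = d * ε := Complex.conj_conj _
      have hcB₃ : conj B₃ = d ^ 2 * ε ^ 3 := Complex.conj_conj _
      have hb : b₂ = √2 * ε * (conj d * conj ε) + ε * (√2 * conj ε) := by
        rw [hb₂, mulShift, hampB _ hε1, hampB _ hB₂1, map_mul, Complex.conj_ofReal, hB₂, map_mul]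
      rw [hampB _ hε1, hampB _ hB₂1, hcB₂] at ha₂
      rw [hampB _ hε1, hampB _ hB₂1, hampB _ hB₃1, hcB₂, hcB₃]
      generalize amp α₂ b₂ = a₂ at ha₂ ha₂0 ⊢
      have e1 : 1 + ε * (d * ε) / (√2 * ε * (√2 * ε)) = a₂ / (√2 * ε * (√2 * ε)) := by
        rw [ha₂]; field_simp
      have e2 : 1 + b₂ * (d ^ 2 * ε ^ 3) / (a₂ * (√2 * ε)) =
          (a₂ * (√2 * ε) + b₂ * (d ^ 2 * ε ^ 3)) / (a₂ * (√2 * ε)) := by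
        field_simp
      rw [e1, e2, div_mul_div_comm, div_eq_iff (by simp [h20, hε0, ha₂0]), hb]
      linear_combination a₂ * (√2 * ε * ha₂ + √2 * ε ^ 3 * (d * conj d * d + d ^ 2) * hεc +
        √2 * ε ^ 3 * d * hdc - √2 * ε ^ 3 * (d + d ^ 2 / 2) * h2)
    rw [e, arg_optimal_hexagon hd] at harg
    rw [mulTime] at hα₂
    rw [leastTime, mulTime]
    linarith

/-! ### From flows back to lightlike paths -/

theorem coords_joins {n : ℕ} (p : LightlikePath n) (i : Fin n) : ∃ η > 0,
    Joins η (liftTime (p.node i.castSucc), shift (p.node i.castSucc))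
      (liftTime (p.node i.succ), shift (p.node i.succ)) := by
  obtain ⟨η, σ, hη, h⟩ := exists_isFlow (p.isGeodesic i)
  exact ⟨η, hη, σ, _, _, h, by simp only [p.seg_zero], by simp only [p.seg_one]⟩

theorem six_lt_of_closed {n : ℕ} (hn : 0 < n) (p : LightlikePath n) (hp : p.target = p.source) :
    6 < n := by
  by_contra! hle
  refine not_closed_of_le_six hn hle (fun i =>
    (liftTime (p.node (Fin.ofNat (n + 1) i)), shift (p.node (Fin.ofNat (n + 1) i))))
    (fun i hi => ?_) ?_
  · have h1 : Fin.ofNat (n + 1) i = (⟨i, hi⟩ : Fin n).castSucc :=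
      Fin.ext (Nat.mod_eq_of_lt (by omega))
    have h2 : Fin.ofNat (n + 1) (i + 1) = (⟨i, hi⟩ : Fin n).succ :=
      Fin.ext (Nat.mod_eq_of_lt (by omega))
    rw [h1, h2]
    exact coords_joins p ⟨i, hi⟩
  · have h1 : Fin.ofNat (n + 1) n = Fin.last n := Fin.ext (Nat.mod_eq_of_lt (by omega))
    have h2 : Fin.ofNat (n + 1) 0 = 0 := rfl
    have hp' : p.node (Fin.last n) = p.node 0 := hp
    simp only [h1, h2, hp']

theorem tauMin_le_of_meetsHorizon (p : LightlikePath 3) (h0 : p.source = origin)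
    (hm : p.MeetsHorizon) : tauMin ≤ tau p.target := by
  obtain ⟨η₁, σ₁, -, h₁⟩ := exists_isFlow (p.isGeodesic 0)
  obtain ⟨η₂, σ₂, -, h₂⟩ := exists_isFlow (p.isGeodesic 1)
  obtain ⟨η₃, σ₃, -, h₃⟩ := exists_isFlow (p.isGeodesic 2)
  have e0 : p.seg 0 0 = 0 := (p.seg_zero 0).trans h0
  have e1 : p.seg 0 1 = p.seg 1 0 := (p.seg_one 0).trans (p.seg_zero 1).symm
  have e2 : p.seg 1 1 = p.seg 2 0 := (p.seg_one 1).trans (p.seg_zero 2).symm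
  have e3 : p.seg 2 1 = p.target := p.seg_one 2
  have key := leastTime_le_or_inside h₁ h₂ h₃ (by simp [e0, liftTime])
    (by simp [e0, shift, planar]) (by rw [e1]) (by rw [e1]) (by rw [e2]) (by rw [e2])
  simp only [norm_shift] at key
  rcases key with h | ⟨i₁, i₂, i₃⟩
  · rw [tauMin_eq, ← sqrt_two_mul_liftTime, ← e3]
    exact mul_le_mul_of_nonneg_left h (sqrt_nonneg _)
  · obtain ⟨i, s, hs, hr⟩ := hm
    fin_cases i
    exacts [absurd hr (i₁ s hs).ne, absurd hr (i₂ s hs).ne, absurd hr (i₃ s hs).ne]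

theorem meetsHorizon_of_radius_node_one (p : LightlikePath 3) (h : radius (p.node 1) = 1) :
    p.MeetsHorizon :=
  ⟨0, 1, right_mem_Icc.2 zero_le_one, by rw [p.seg_one]; exact h⟩

end Goedel

end

theorem proposition9 :
    -- the minimum of `τ` at the endpoint, over the 3-segment paths from the origin that reach the
    -- horizon, and over those whose first segment ends on the horizon
    IsLeast {t : ℝ | ∃ p : Goedel.LightlikePath 3, p.source = Goedel.origin ∧
        p.MeetsHorizon ∧ t = Goedel.tau p.target} Goedel.tauMin ∧
    IsLeast {t : ℝ | ∃ p : Goedel.LightlikePath 3, p.source = Goedel.origin ∧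
        Goedel.radius (p.node 1) = 1 ∧ t = Goedel.tau p.target} Goedel.tauMin ∧
    -- its numerical value, which is positive
    |Goedel.tauMin - 0.3052| < 0.00005 ∧ 0 < Goedel.tauMin ∧
    -- a closed lightlike path, based at any event, has more than six segments
    (∀ n : ℕ, 0 < n → ∀ p : Goedel.LightlikePath n, p.target = p.source → 6 < n) := by
  obtain ⟨p, h0, h1, ht⟩ := Goedel.exists_optimal_path
  refine ⟨⟨⟨p, h0, Goedel.meetsHorizon_of_radius_node_one p h1, ht⟩, ?_⟩, ⟨⟨p, h0, h1, ht⟩, ?_⟩,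
    Goedel.tauMin_approx, Goedel.tauMin_pos, fun n hn p => Goedel.six_lt_of_closed hn p⟩
  · rintro t ⟨q, q0, qm, rfl⟩
    exact Goedel.tauMin_le_of_meetsHorizon q q0 qm
  · rintro t ⟨q, q0, q1, rfl⟩
    exact Goedel.tauMin_le_of_meetsHorizon q q0 (Goedel.meetsHorizon_of_radius_node_one q q1)
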